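/- Let $\pi(z_1,z_2)=(z_1+z_2,z_1z_2)$, $\mathbb G_2=\pi(\mathbb D^2)$, $\Gamma=\pi(\overline{\mathbb D}^2)$ (the closed symmetrized bidisc) and $b\Gamma=\pi(\mathbb T^2)$ (its distinguished boundary). A polynomial $p\in\mathbb C[z_1,z_2]$ with zero set $Z(p)$ is called $\Gamma$-distinguished if $Z(p)\cap\mathbb G_2\neq\emptyset$ and $Z(p)\cap\partial\Gamma=Z(p)\cap b\Gamma$. A commuting pair $(S,P)$ of bounded operators on a complex Hilbert space is a $\Gamma$-contraction if $\Gamma$ is a spectral set for it, i.e. its Taylor joint spectrum is contained in $\Gamma$ and $\|f(S,P)\|\le\sup_\Gamma|f|$ for every rational function $f=p/q$ with $p,q\in\mathbb C[z_1,z_2]$ and $q$ without zeros in $\Gamma$. It is a $\Gamma$-distinguished $\Gamma$-contraction if, moreover, $q(S,P)=0$ for some $\Gamma$-distinguished polynomial $q$. Let $(S,P)$ be a $\Gamma$-distinguished $\Gamma$-contraction on a complex Hilbert space $\mathcal H$. Let $D_P=(I-P^*P)^{1/2}$ and $\mathcal D_P=\overline{\operatorname{Ran}}\,D_P$, and suppose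 that $\dim\mathcal D_P<\infty$. Let $A\in\mathcal B(\mathcal D_P)$ be the fundamental operator of $(S,P)$, i.e. the unique solution of $S-S^*P=D_PAD_P$. Let $T_A$ and $V_0$ be the operators on $\mathcal H\oplus\ell^2(\mathcal D_P)$ given by $$T_A(x_0,x_1,x_2,\dots)=(Sx_0,\;A^*D_Px_0+Ax_1,\;A^*x_1+Ax_2,\;A^*x_2+Ax_3,\dots),$$ $$V_0(x_0,x_1,x_2,\dots)=(Px_0,\;D_Px_0,\;x_1,\;x_2,\dots)$$ (the pair $(T_A,V_0)$ is a minimal $\Gamma$-isometric dilation of $(S,P)$). Then the following are equivalent: 1. $(T_A,V_0)$ is a $\Gamma$-distinguished $\Gamma$-contraction; 2. the pair $(A,0)$ on $\mathcal D_P$ is a $\Gamma$-distinguished $\Gamma$-contraction; 3. the spectral radius of $A$ satisfies $r(A)<1$. -/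

import Mathlib

noncomputable section

/-! ### The symmetrized bidisc and `Γ`-distinguished polynomials -/

/-- The symmetrization map `π(z₁, z₂) = (z₁ + z₂, z₁ z₂)`. -/
def symmMap (z : ℂ × ℂ) : ℂ × ℂ := (z.1 + z.2, z.1 * z.2)

/-- The (open) symmetrized bidisc `𝔾₂ = π(𝔻²)`. -/
def openSymmBidisc : Set (ℂ × ℂ) := symmMap '' {z | ‖z.1‖ < 1 ∧ ‖z.2‖ < 1}

/-- The closed symmetrized bidisc `Γ`, the image under `π` of the closed bidisc. -/
def closedSymmBidisc : Set (ℂ × ℂ) := symmMap '' {z | ‖z.1‖ ≤ 1 ∧ ‖z.2‖ ≤ 1}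

/-- The distinguished boundary `bΓ`, the image under `π` of the torus `𝕋²`. -/
def symmBidiscDistBoundary : Set (ℂ × ℂ) := symmMap '' {z | ‖z.1‖ = 1 ∧ ‖z.2‖ = 1}

/-- The value of a polynomial in two variables at a point of `ℂ²`. -/
def polyVal (p : MvPolynomial (Fin 2) ℂ) (z : ℂ × ℂ) : ℂ := MvPolynomial.eval ![z.1, z.2] p

/-- The zero set `Z(p)` in `ℂ²`. -/
def polyZeros (p : MvPolynomial (Fin 2) ℂ) : Set (ℂ × ℂ) := {z | polyVal p z = 0}

/-- `p` is `Γ`-distinguished: `Z(p)` meets `𝔾₂`, and `Z(p) ∩ ∂Γ = Z(p) ∩ bΓ`. -/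
def IsGammaDistinguishedPoly (p : MvPolynomial (Fin 2) ℂ) : Prop :=
  (polyZeros p ∩ openSymmBidisc).Nonempty ∧
    polyZeros p ∩ frontier closedSymmBidisc = polyZeros p ∩ symmBidiscDistBoundary

/-! ### Pairs of operators -/

section Pairs

variable {H : Type*} [NormedAddCommGroup H] [InnerProductSpace ℂ H]

/-- The operator `p(S, P) = ∑ cᵢⱼ Sⁱ Pʲ` for `p = ∑ cᵢⱼ z₁ⁱ z₂ʲ`. -/
def polyOp (p : MvPolynomial (Fin 2) ℂ) (S P : H →L[ℂ] H) : H →L[ℂ] H :=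
  ∑ m ∈ p.support, p.coeff m • (S ^ m 0 * P ^ m 1)

/-- First differential `H → H ⊕ H`, `x ↦ (T₁ x, T₂ x)`, of the Koszul complex of `(T₁, T₂)`. -/
def koszulD0 (T₁ T₂ : H →L[ℂ] H) : H →L[ℂ] H × H := T₁.prod T₂

/-- Second differential `H ⊕ H → H`, `(x, y) ↦ T₁ y - T₂ x`, of the Koszul complex. -/
def koszulD1 (T₁ T₂ : H →L[ℂ] H) : H × H →L[ℂ] H :=
  T₁ ∘L ContinuousLinearMap.snd ℂ H H - T₂ ∘L ContinuousLinearMap.fst ℂ H H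

/-- The Taylor joint spectrum of a (commuting) pair `(S, P)`: the points `(s, p)` for which the
Koszul complex `0 → H → H ⊕ H → H → 0` of `(S - s, P - p)` is not exact. -/
def taylorSpectrum (S P : H →L[ℂ] H) : Set (ℂ × ℂ) :=
  {z | ¬ (Function.Injective (koszulD0 (S - z.1 • 1) (P - z.2 • 1)) ∧
          Function.Exact (koszulD0 (S - z.1 • 1) (P - z.2 • 1))
            (koszulD1 (S - z.1 • 1) (P - z.2 • 1)) ∧
          Function.Surjective (koszulD1 (S - z.1 • 1) (P - z.2 • 1)))}

/-- `(S, P)` is a `Γ`-contraction: a commuting pair having `Γ` as a spectral set, i.e. its Taylor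
joint spectrum lies in `Γ` and, for every rational function `f = p / q` with `q` zero free on `Γ`,
the operator `f(S, P) = p(S, P) q(S, P)⁻¹` (is defined and) has norm at most `sup_Γ |f|`. -/
structure IsGammaContraction (S P : H →L[ℂ] H) : Prop where
  comm : Commute S P
  spectrum_subset : taylorSpectrum S P ⊆ closedSymmBidisc
  vonNeumann : ∀ p q : MvPolynomial (Fin 2) ℂ, (∀ z ∈ closedSymmBidisc, polyVal q z ≠ 0) →
    IsUnit (polyOp q S P) ∧
      ‖polyOp p S P * Ring.inverse (polyOp q S P)‖ ≤
        sSup ((fun z => ‖polyVal p z / polyVal q z‖) '' closedSymmBidisc)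

/-- `(S, P)` is a `Γ`-distinguished `Γ`-contraction: a `Γ`-contraction that is annihilated by some
`Γ`-distinguished polynomial. -/
def IsGammaDistinguished (S P : H →L[ℂ] H) : Prop :=
  IsGammaContraction S P ∧
    ∃ q : MvPolynomial (Fin 2) ℂ, IsGammaDistinguishedPoly q ∧ polyOp q S P = 0

end Pairs

/-! ### Defect operator and fundamental operator -/

section Defect

variable {H : Type*} [NormedAddCommGroup H] [InnerProductSpace ℂ H] [CompleteSpace H]

/-- The defect operator `D_P = (I - P* P)^{1/2}`. -/
def defectOp (P : H →L[ℂ] H) : H →L[ℂ] H :=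
  CFC.sqrt (1 - ContinuousLinearMap.adjoint P * P)

/-- The defect space `𝒟_P`, the closure of the range of `D_P`. -/
def defectSpace (P : H →L[ℂ] H) : Submodule ℂ H :=
  (LinearMap.range (defectOp P).toLinearMap).topologicalClosure

instance defectSpace.instCompleteSpace (P : H →L[ℂ] H) : CompleteSpace (defectSpace P) :=
  Submodule.topologicalClosure.completeSpace _

/-- `D_P` as an operator from `H` to `𝒟_P`. -/
def defectOpTo (P : H →L[ℂ] H) : H →L[ℂ] defectSpace P :=
  (defectOp P).codRestrict (defectSpace P) fun x =>
    Submodule.le_topologicalClosure _ (LinearMap.mem_range_self (defectOp P).toLinearMap x)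

/-- `A ∈ B(𝒟_P)` is the fundamental operator of `(S, P)`: it solves `S - S* P = D_P A D_P`.
(Such an `A` is unique, since `D_P` has dense range in `𝒟_P` and is injective on `𝒟_P`.) -/
def IsFundamentalOperator (S P : H →L[ℂ] H) (A : defectSpace P →L[ℂ] defectSpace P) : Prop :=
  S - ContinuousLinearMap.adjoint S * P =
    defectOp P ∘L (defectSpace P).subtypeL ∘L A ∘L defectOpTo P

end Defect

/-! ### Operators on `ℓ²(E)` -/

section EllTwo

/-- The Hilbert space `ℓ²(E)` of square summable sequences in `E`. -/
abbrev EllTwo (E : Type*) [NormedAddCommGroup E] : Type _ := lp (fun _ : ℕ => E) 2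

theorem EllTwo.summable_sq {E : Type*} [NormedAddCommGroup E] (x : EllTwo E) : Summable fun n => ‖x n‖ ^ 2 := by
  have h := (memℓp_gen_iff (p := 2) (by norm_num)).1 (lp.memℓp x)
  simpa using h

theorem EllTwo.norm_sq {E : Type*} [NormedAddCommGroup E] (x : EllTwo E) : ‖x‖ ^ 2 = ∑' n, ‖x n‖ ^ 2 := by
  have h := lp.norm_rpow_eq_tsum (p := 2) (by norm_num) x
  simpa using h

theorem EllTwo.memℓp {E : Type*} [NormedAddCommGroup E] {f : ℕ → E} (h : Summable fun n => ‖f n‖ ^ 2) : Memℓp f 2 :=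
  memℓp_gen (by simpa using h)

variable {E : Type*} [NormedAddCommGroup E] [InnerProductSpace ℂ E]

theorem EllTwo.summable_diag (A : E →L[ℂ] E) (x : EllTwo E) :
    Summable fun n => ‖A (x n)‖ ^ 2 := by
  refine Summable.of_nonneg_of_le (fun n => by positivity) (fun n => ?_)
    ((EllTwo.summable_sq x).mul_left (‖A‖ ^ 2))
  rw [← mul_pow]
  exact pow_le_pow_left₀ (norm_nonneg _) (A.le_opNorm _) 2

/-- The diagonal operator `(x₁, x₂, …) ↦ (A x₁, A x₂, …)` on `ℓ²(E)`. -/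
def ellTwoDiag (A : E →L[ℂ] E) : EllTwo E →L[ℂ] EllTwo E :=
  LinearMap.mkContinuous
    { toFun := fun x => ⟨fun n => A (x n), EllTwo.memℓp (EllTwo.summable_diag A x)⟩
      map_add' := fun x y => lp.ext (funext fun n => A.map_add (x n) (y n))
      map_smul' := fun c x => lp.ext (funext fun n => A.map_smul c (x n)) }
    ‖A‖ (fun x => by
      refine le_of_sq_le_sq ?_ (by positivity)
      rw [mul_pow, EllTwo.norm_sq, EllTwo.norm_sq, ← tsum_mul_left]
      refine Summable.tsum_le_tsum (fun n => ?_) (EllTwo.summable_diag A x)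
        ((EllTwo.summable_sq x).mul_left _)
      rw [← mul_pow]
      exact pow_le_pow_left₀ (norm_nonneg _) (A.le_opNorm _) 2)

/-- The sequence `a, x₁, x₂, …`. -/
def consSeq {E : Type*} (a : E) (x : ℕ → E) : ℕ → E
  | 0 => a
  | n + 1 => x n

theorem EllTwo.hasSum_cons {E : Type*} [NormedAddCommGroup E] (a : E) (x : EllTwo E) :
    HasSum (fun n => ‖consSeq a x n‖ ^ 2) (‖a‖ ^ 2 + ‖x‖ ^ 2) := by
  have h := (hasSum_nat_add_iff (f := fun n => ‖consSeq a x n‖ ^ 2) 1).1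
    (EllTwo.summable_sq x).hasSum
  rw [EllTwo.norm_sq, add_comm]
  simpa [consSeq] using h

/-- The operator `(a, (x₁, x₂, …)) ↦ (a, x₁, x₂, …)` from `E ⊕ ℓ²(E)` to `ℓ²(E)`. -/
def ellTwoCons : E × EllTwo E →L[ℂ] EllTwo E :=
  LinearMap.mkContinuous
    { toFun := fun x => ⟨consSeq x.1 x.2, EllTwo.memℓp (EllTwo.hasSum_cons x.1 x.2).summable⟩
      map_add' := fun x y => lp.ext (funext fun n => match n with
        | 0 => rfl
        | _ + 1 => rfl)
      map_smul' := fun c x => lp.ext (funext fun n => match n with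
        | 0 => rfl
        | _ + 1 => rfl) }
    2 (fun x => by
      refine le_of_sq_le_sq ?_ (by positivity)
      rw [EllTwo.norm_sq]
      refine (EllTwo.hasSum_cons x.1 x.2).tsum_eq.le.trans ?_
      have h1 := norm_fst_le x
      have h2 := norm_snd_le x
      nlinarith [norm_nonneg x.1, norm_nonneg x.2, norm_nonneg x])

end EllTwo

/-! ### The pair `(T_A, V₀)` -/

section Dilation

variable {H : Type*} [NormedAddCommGroup H] [InnerProductSpace ℂ H] [CompleteSpace H]

/-- The Hilbert space `H ⊕ ℓ²(𝒟_P)`. -/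
abbrev DilationSpace (P : H →L[ℂ] H) : Type _ := WithLp 2 (H × EllTwo (defectSpace P))

/-- `T_A(x₀, x₁, x₂, …) = (S x₀, A* D_P x₀ + A x₁, A* x₁ + A x₂, A* x₂ + A x₃, …)`. -/
def dilationT (S P : H →L[ℂ] H) (A : defectSpace P →L[ℂ] defectSpace P) :
    DilationSpace P →L[ℂ] DilationSpace P :=
  (WithLp.prodContinuousLinearEquiv 2 ℂ H (EllTwo (defectSpace P))).symm.toContinuousLinearMap ∘L
    ((S ∘L WithLp.fstL 2 ℂ H (EllTwo (defectSpace P))).prod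
      (ellTwoDiag A ∘L WithLp.sndL 2 ℂ H (EllTwo (defectSpace P)) +
        ellTwoCons ∘L
          ((ContinuousLinearMap.adjoint A ∘L defectOpTo P ∘L
              WithLp.fstL 2 ℂ H (EllTwo (defectSpace P))).prod
            (ellTwoDiag (ContinuousLinearMap.adjoint A) ∘L
              WithLp.sndL 2 ℂ H (EllTwo (defectSpace P))))))

/-- `V₀(x₀, x₁, x₂, …) = (P x₀, D_P x₀, x₁, x₂, …)`. -/
def dilationV (P : H →L[ℂ] H) : DilationSpace P →L[ℂ] DilationSpace P :=
  (WithLp.prodContinuousLinearEquiv 2 ℂ H (EllTwo (defectSpace P))).symm.toContinuousLinearMap ∘L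
    ((P ∘L WithLp.fstL 2 ℂ H (EllTwo (defectSpace P))).prod
      (ellTwoCons ∘L
        ((defectOpTo P ∘L WithLp.fstL 2 ℂ H (EllTwo (defectSpace P))).prod
          (WithLp.sndL 2 ℂ H (EllTwo (defectSpace P))))))

theorem dilationT_apply_fst (S P : H →L[ℂ] H) (A : defectSpace P →L[ℂ] defectSpace P)
    (x : DilationSpace P) : (dilationT S P A x).fst = S x.fst := rfl

theorem dilationT_apply_snd_zero (S P : H →L[ℂ] H) (A : defectSpace P →L[ℂ] defectSpace P)
    (x : DilationSpace P) : (dilationT S P A x).snd 0 =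
      ContinuousLinearMap.adjoint A (defectOpTo P x.fst) + A (x.snd 0) :=
  add_comm _ _

theorem dilationT_apply_snd_succ (S P : H →L[ℂ] H) (A : defectSpace P →L[ℂ] defectSpace P)
    (x : DilationSpace P) (n : ℕ) : (dilationT S P A x).snd (n + 1) =
      ContinuousLinearMap.adjoint A (x.snd n) + A (x.snd (n + 1)) :=
  add_comm _ _

theorem dilationV_apply_fst (P : H →L[ℂ] H) (x : DilationSpace P) :
    (dilationV P x).fst = P x.fst := rfl

theorem dilationV_apply_snd_zero (P : H →L[ℂ] H) (x : DilationSpace P) :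
    (dilationV P x).snd 0 = defectOpTo P x.fst := rfl

theorem dilationV_apply_snd_succ (P : H →L[ℂ] H) (x : DilationSpace P) (n : ℕ) :
    (dilationV P x).snd (n + 1) = x.snd n := rfl

end Dilation

end

open ComplexConjugate

/-! The implications run 1 ⇒ 2 ⇒ 3 ⇒ 1. Both `(T_A, V₀)` and `(A, 0)` must be shown to be
`Γ`-contractions, and this is the longer part of the work.

Positivity of the `Γ`-contraction `(S, P)` bounds the numerical radius of `A` by one
(`IsFundamentalOperator.norm_inner_le`). The dilation satisfies the algebraic relations `V*V = 1`,
`T = T*V`, `TV = VT` (`isAlgGammaIsometry_dilation`). Under these relations rational functions of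
the pair have norm equal to spectral radius, so once `1 - bT + b²V` is invertible for all `|b| < 1`,
Gelfand theory gives the von Neumann inequality on `Γ` (`IsAlgGammaIsometry.isGammaContraction`).
Invertibility follows by deforming `b` to `0`, using that the operator stays bounded below
(`dilation_bounded_below`).

The pair `(A, 0)` is the compression of `(T_A, V₀)` to the zeroth coordinate of the invariant
subspace `ℓ²(𝒟_P)`. It therefore inherits the norm bounds (`isGammaContraction_fundamental`) and any
annihilating polynomial, which is 1 ⇒ 2. For 2 ⇒ 3, an eigenvalue `l` of `A` puts `(l, 0)` in the
zero set of the annihilating polynomial. If `|l| = 1` this point lies on `∂Γ` but not on `bΓ`.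

For 3 ⇒ 1, the annihilating polynomial is `det(s - A - pA*) · q`, where `q` annihilates `(S, P)`.
The factor `q` maps the dilation space into `ℓ²(𝒟_P)`, and the determinant kills `ℓ²(𝒟_P)` by a
Cayley-Hamilton argument (`polyOp_det_pencilMatrix_apply`). When `r(A) < 1`, zeros of the
determinant with `|p| < 1` are interior to `Γ` (`norm_sub_lt_of_eigenvector`), so its zeros on `∂Γ`
lie on `bΓ`. -/

/-! ### Geometry of `Γ` and its boundary. -/

theorem isCompact_closedSymmBidisc : IsCompact closedSymmBidisc := by
  have h : {z : ℂ × ℂ | ‖z.1‖ ≤ 1 ∧ ‖z.2‖ ≤ 1} =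
      Metric.closedBall (0 : ℂ) 1 ×ˢ Metric.closedBall (0 : ℂ) 1 := by
    ext z; simp
  unfold closedSymmBidisc
  rw [h]
  refine ((isCompact_closedBall _ _).prod (isCompact_closedBall _ _)).image ?_
  unfold symmMap
  fun_prop

theorem norm_fst_le_of_mem_closedSymmBidisc {z : ℂ × ℂ} (hz : z ∈ closedSymmBidisc) :
    ‖z.1‖ ≤ 2 := by
  obtain ⟨w, ⟨h1, h2⟩, rfl⟩ := hz
  exact (norm_add_le _ _).trans (by linarith)

theorem norm_snd_le_of_mem_closedSymmBidisc {z : ℂ × ℂ} (hz : z ∈ closedSymmBidisc) :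
    ‖z.2‖ ≤ 1 := by
  obtain ⟨w, ⟨h1, h2⟩, rfl⟩ := hz
  simp only [symmMap, norm_mul]
  exact mul_le_one₀ h1 (norm_nonneg _) h2

theorem frontier_closedSymmBidisc_subset : frontier closedSymmBidisc ⊆ closedSymmBidisc :=
  isCompact_closedSymmBidisc.isClosed.frontier_subset

/-- A point of `Γ` that is a limit of points outside `Γ` along a ray lies on the boundary. -/
theorem mem_frontier_of_smul_notMem {z d : ℂ × ℂ} (hz : z ∈ closedSymmBidisc)
    (h : ∀ t : ℝ, 0 < t → z + t • d ∉ closedSymmBidisc) : z ∈ frontier closedSymmBidisc := by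
  refine ⟨subset_closure hz, fun hi => ?_⟩
  have hc : Filter.Tendsto (fun t : ℝ => z + t • d) (nhdsWithin 0 (Set.Ioi 0)) (nhds z) := by
    have : Continuous fun t : ℝ => z + t • d := by fun_prop
    have h0 := this.tendsto 0
    simp only [zero_smul, add_zero] at h0
    exact h0.mono_left nhdsWithin_le_nhds
  have h1 := hc.eventually (mem_interior_iff_mem_nhds.1 hi)
  obtain ⟨t, ht, ht0⟩ := (h1.and self_mem_nhdsWithin).exists
  exact h t ht0 ht

theorem symmBidiscDistBoundary_subset_frontier :
    symmBidiscDistBoundary ⊆ frontier closedSymmBidisc := by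
  rintro _ ⟨w, ⟨h1, h2⟩, rfl⟩
  refine mem_frontier_of_smul_notMem (d := (0, w.1 * w.2)) ⟨w, ⟨h1.le, h2.le⟩, rfl⟩ fun t ht hm => ?_
  have h := norm_snd_le_of_mem_closedSymmBidisc hm
  have e : (symmMap w + t • ((0, w.1 * w.2) : ℂ × ℂ)).2 = ((1 + t : ℝ) : ℂ) * (w.1 * w.2) := by
    simp [symmMap]; ring
  rw [e, norm_mul, norm_mul, h1, h2, Complex.norm_real, Real.norm_eq_abs,
    abs_of_pos (by linarith)] at h
  linarith

theorem norm_snd_of_mem_symmBidiscDistBoundary {z : ℂ × ℂ} (hz : z ∈ symmBidiscDistBoundary) :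
    ‖z.2‖ = 1 := by
  obtain ⟨w, ⟨h1, h2⟩, rfl⟩ := hz
  simp [symmMap, h1, h2]

theorem mem_symmBidiscDistBoundary_of_norm_snd {z : ℂ × ℂ} (hz : z ∈ closedSymmBidisc)
    (h : ‖z.2‖ = 1) : z ∈ symmBidiscDistBoundary := by
  obtain ⟨w, ⟨h1, h2⟩, rfl⟩ := hz
  simp only [symmMap, norm_mul] at h
  refine ⟨w, ⟨?_, ?_⟩, rfl⟩ <;> nlinarith [norm_nonneg w.1, norm_nonneg w.2]

theorem mk_zero_mem_frontier {l : ℂ} (hl : ‖l‖ = 1) : (l, 0) ∈ frontier closedSymmBidisc := by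
  refine mem_frontier_of_smul_notMem (d := (l, 0)) ⟨(l, 0), by simp [hl], by simp [symmMap]⟩ ?_
  rintro t ht ⟨w, ⟨h1, h2⟩, hw⟩
  have e1 := congrArg Prod.fst hw
  have e2 := congrArg Prod.snd hw
  simp only [symmMap, Prod.fst_add, Prod.snd_add, Prod.smul_mk, smul_zero, add_zero,
    mul_eq_zero] at e1 e2
  have e3 : l + t • l = ((1 + t : ℝ) : ℂ) * l := by
    push_cast; rw [Complex.real_smul]; ring
  have e4 : ‖w.1 + w.2‖ ≤ 1 := by
    rcases e2 with h | h <;> simp [h, h1, h2]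
  rw [e1, e3, norm_mul, hl, Complex.norm_real, Real.norm_eq_abs, abs_of_pos (by linarith)] at e4
  linarith

/-- Every point of `ℂ²` is in the range of the symmetrization map. -/
theorem symmMap_surjective : Function.Surjective symmMap := by
  rintro ⟨s, p⟩
  obtain ⟨d, hd⟩ := IsAlgClosed.exists_pow_nat_eq (s ^ 2 - 4 * p) (n := 2) (by norm_num)
  refine ⟨((s + d) / 2, (s - d) / 2), ?_⟩
  simp only [symmMap, Prod.mk.injEq]
  constructor
  · ring
  · linear_combination (-1 / 4 : ℂ) * hd

/-- If `|z| ≥ 1`, the hypothesis forces `|zw| < 1`, hence `|w| < 1`. The left side is then at least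
`(|z| + |w|)(1 - |zw|)`, so `|z| + |w| < 1 + |zw|`, i.e. `(1 - |z|)(1 - |w|) > 0`, a contradiction.
-/
theorem symmMap_norm_lt_one {z w : ℂ}
    (h : ‖(z + w) - conj (z + w) * (z * w)‖ < 1 - ‖z * w‖ ^ 2) : ‖z‖ < 1 := by
  by_contra hz
  rw [not_lt] at hz
  have e : (z + w) - conj (z + w) * (z * w) =
      z * ((1 - ‖w‖ ^ 2 : ℝ) : ℂ) - w * ((‖z‖ ^ 2 - 1 : ℝ) : ℂ) := by
    push_cast
    rw [← Complex.conj_mul', ← Complex.conj_mul']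
    simp only [map_add]
    ring
  have hp : ‖z‖ * ‖w‖ < 1 := by
    have := norm_nonneg ((z + w) - conj (z + w) * (z * w))
    rw [norm_mul] at h
    nlinarith [mul_nonneg (norm_nonneg z) (norm_nonneg w)]
  have hw : ‖w‖ < 1 := by nlinarith [norm_nonneg w]
  have h1 := norm_sub_norm_le (z * ((1 - ‖w‖ ^ 2 : ℝ) : ℂ)) (w * ((‖z‖ ^ 2 - 1 : ℝ) : ℂ))
  rw [← e, norm_mul, norm_mul, Complex.norm_real, Complex.norm_real, Real.norm_eq_abs,
    Real.norm_eq_abs, abs_of_nonneg (by nlinarith [norm_nonneg w]),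
    abs_of_nonneg (by nlinarith)] at h1
  rw [norm_mul] at h
  have h2 : (‖z‖ + ‖w‖) * (1 - ‖z‖ * ‖w‖) < (1 + ‖z‖ * ‖w‖) * (1 - ‖z‖ * ‖w‖) := by
    nlinarith
  have h3 := lt_of_mul_lt_mul_right h2 (by linarith)
  nlinarith

/-- Points `(s, p)` with `|s - s̄ p| < 1 - |p|²` are interior points of `Γ`. -/
theorem notMem_frontier_of_lt {s p : ℂ} (h : ‖s - conj s * p‖ < 1 - ‖p‖ ^ 2) :
    (s, p) ∉ frontier closedSymmBidisc := by
  have ho : IsOpen {z : ℂ × ℂ | ‖z.1 - conj z.1 * z.2‖ < 1 - ‖z.2‖ ^ 2} :=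
    isOpen_lt (by fun_prop) (by fun_prop)
  have hs : {z : ℂ × ℂ | ‖z.1 - conj z.1 * z.2‖ < 1 - ‖z.2‖ ^ 2} ⊆ closedSymmBidisc := by
    intro z hz
    obtain ⟨w, rfl⟩ := symmMap_surjective z
    simp only [symmMap, Set.mem_ofPred_eq] at hz
    refine ⟨w, ⟨(symmMap_norm_lt_one hz).le, ?_⟩, rfl⟩
    rw [add_comm w.1, mul_comm w.1] at hz
    exact (symmMap_norm_lt_one hz).le
  intro hf
  exact hf.2 (interior_maximal hs ho h)

/-- The difference of squares is `2|1 - w|²(1 - |z|²) + 2|1 - z|²(1 - |w|²)`. This makes `(2p -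
s)/(2 - s)` a test function bounded by one on `Γ`. -/
theorem norm_two_mul_sub_le {z w : ℂ} (hz : ‖z‖ ≤ 1) (hw : ‖w‖ ≤ 1) :
    ‖2 * (z * w) - (z + w)‖ ≤ ‖2 - (z + w)‖ := by
  refine le_of_sq_le_sq ?_ (norm_nonneg _)
  have hz' : ‖z‖ ^ 2 ≤ 1 := by nlinarith [norm_nonneg z]
  have hw' : ‖w‖ ^ 2 ≤ 1 := by nlinarith [norm_nonneg w]
  rw [← Complex.normSq_eq_norm_sq, Complex.normSq_apply] at hz' hw'
  rw [← Complex.normSq_eq_norm_sq, ← Complex.normSq_eq_norm_sq, Complex.normSq_apply,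
    Complex.normSq_apply]
  simp only [Complex.sub_re, Complex.sub_im, Complex.mul_re, Complex.mul_im, Complex.add_re,
    Complex.add_im, Complex.re_ofNat, Complex.im_ofNat]
  have e1 : 0 ≤ ((1 - w.re) ^ 2 + w.im ^ 2) * (1 - (z.re * z.re + z.im * z.im)) :=
    mul_nonneg (by positivity) (by linarith)
  have e2 : 0 ≤ ((1 - z.re) ^ 2 + z.im ^ 2) * (1 - (w.re * w.re + w.im * w.im)) :=
    mul_nonneg (by positivity) (by linarith)
  nlinarith

/-- A point outside `Γ` is `π(a, c)` with `|a| > 1`. -/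
theorem exists_eq_of_notMem_closedSymmBidisc {z : ℂ × ℂ} (hz : z ∉ closedSymmBidisc) :
    ∃ a c : ℂ, 1 < ‖a‖ ∧ z = (a + c, a * c) := by
  obtain ⟨w, rfl⟩ := symmMap_surjective z
  by_cases h1 : ‖w.1‖ ≤ 1
  · refine ⟨w.2, w.1, lt_of_not_ge fun h2 => hz ⟨w, ⟨h1, h2⟩, rfl⟩, ?_⟩
    rw [add_comm, mul_comm]; rfl
  · exact ⟨w.1, w.2, lt_of_not_ge h1, rfl⟩

/-! ### Polynomial functional calculus and the inequalities satisfied by a `Γ`-contraction. -/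

section PolynomialCalculus

variable {H : Type*} [NormedAddCommGroup H] [InnerProductSpace ℂ H]

/-- The bicommutant of a pair of operators. -/
def bicommutant (S P : H →L[ℂ] H) : Subalgebra ℂ (H →L[ℂ] H) :=
  Subalgebra.centralizer ℂ (Subalgebra.centralizer ℂ {S, P} : Set (H →L[ℂ] H))

theorem left_mem_bicommutant (S P : H →L[ℂ] H) : S ∈ bicommutant S P := by
  intro g hg
  exact (hg S (by simp)).symm

theorem right_mem_bicommutant (S P : H →L[ℂ] H) : P ∈ bicommutant S P := by
  intro g hg
  exact (hg P (by simp)).symm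

theorem bicommutant_mul_comm {S P : H →L[ℂ] H} (h : Commute S P) (x y : bicommutant S P) :
    x * y = y * x := by
  apply Subtype.ext
  refine y.2 x ?_
  intro g hg
  refine (x.2 g ?_)
  intro g' hg'
  rcases hg with rfl | rfl <;> rcases hg' with rfl | rfl
  exacts [rfl, h.eq.symm, h.eq, rfl]

/-- The bicommutant of a commuting pair as a commutative normed ring. -/
@[reducible] noncomputable def bicommutantNormedCommRing {S P : H →L[ℂ] H} (h : Commute S P) :
    NormedCommRing (bicommutant S P) :=
  { (inferInstance : NormedRing (bicommutant S P)) with mul_comm := bicommutant_mul_comm h }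

theorem isClosed_bicommutant (S P : H →L[ℂ] H) :
    IsClosed (bicommutant S P : Set (H →L[ℂ] H)) :=
  Set.isClosed_centralizer _

theorem isUnit_bicommutant_iff {S P : H →L[ℂ] H} (x : bicommutant S P) :
    IsUnit x ↔ IsUnit (x : H →L[ℂ] H) := by
  refine ⟨fun h => h.map (bicommutant S P).val, fun h => ?_⟩
  obtain ⟨u, hu⟩ := h
  have hm : (↑u⁻¹ : H →L[ℂ] H) ∈ bicommutant S P := by
    intro g hg
    have h1 : Commute g (u : H →L[ℂ] H) := by
      rw [hu]; exact x.2 g hg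
    exact (h1.units_inv_right).eq
  refine ⟨⟨x, ⟨_, hm⟩, Subtype.ext ?_, Subtype.ext ?_⟩, rfl⟩
  · simp [← hu]
  · simp [← hu]

theorem coe_aeval_bicommutant {S P : H →L[ℂ] H} (h : Commute S P)
    (q : MvPolynomial (Fin 2) ℂ) :
    letI := bicommutantNormedCommRing h
    ((MvPolynomial.aeval (![⟨S, left_mem_bicommutant S P⟩, ⟨P, right_mem_bicommutant S P⟩] :
      Fin 2 → bicommutant S P) q : bicommutant S P) : H →L[ℂ] H) = polyOp q S P := by
  let _ := bicommutantNormedCommRing h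
  rw [MvPolynomial.aeval_def, MvPolynomial.eval₂_eq']
  simp only [Fin.prod_univ_two, polyOp]
  rw [← Subalgebra.coe_val, map_sum]
  refine Finset.sum_congr rfl fun m _ => ?_
  rw [← Algebra.smul_def]
  rfl

/-- The polynomial functional calculus of a commuting pair, as an algebra homomorphism. -/
noncomputable def polyOpHom {S P : H →L[ℂ] H} (h : Commute S P) :
    MvPolynomial (Fin 2) ℂ →ₐ[ℂ] (H →L[ℂ] H) :=
  letI := bicommutantNormedCommRing h
  (bicommutant S P).val.comp (MvPolynomial.aeval
    (![⟨S, left_mem_bicommutant S P⟩, ⟨P, right_mem_bicommutant S P⟩] :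
      Fin 2 → bicommutant S P))

theorem polyOpHom_apply {S P : H →L[ℂ] H} (h : Commute S P) (q : MvPolynomial (Fin 2) ℂ) :
    polyOpHom h q = polyOp q S P :=
  coe_aeval_bicommutant h q

theorem polyOpHom_X_zero {S P : H →L[ℂ] H} (h : Commute S P) :
    polyOpHom h (MvPolynomial.X 0) = S := by
  let _ := bicommutantNormedCommRing h
  simp only [polyOpHom, AlgHom.comp_apply, MvPolynomial.aeval_X]
  rfl

theorem polyOpHom_X_one {S P : H →L[ℂ] H} (h : Commute S P) :
    polyOpHom h (MvPolynomial.X 1) = P := by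
  let _ := bicommutantNormedCommRing h
  simp only [polyOpHom, AlgHom.comp_apply, MvPolynomial.aeval_X]
  rfl

theorem polyOpHom_C {S P : H →L[ℂ] H} (h : Commute S P) (c : ℂ) :
    polyOpHom h (MvPolynomial.C c) = c • 1 := by
  rw [← MvPolynomial.algebraMap_eq, AlgHom.commutes, Algebra.algebraMap_eq_smul_one]

theorem polyOp_mul {S P : H →L[ℂ] H} (h : Commute S P) (p q : MvPolynomial (Fin 2) ℂ) :
    polyOp (p * q) S P = polyOp p S P * polyOp q S P := by
  rw [← polyOpHom_apply h, map_mul, polyOpHom_apply, polyOpHom_apply]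

theorem polyOp_comm {S P : H →L[ℂ] H} (h : Commute S P) (p q : MvPolynomial (Fin 2) ℂ) :
    Commute (polyOp p S P) (polyOp q S P) := by
  rw [Commute, SemiconjBy, ← polyOp_mul h, mul_comm, polyOp_mul h]

theorem polyVal_mul (p q : MvPolynomial (Fin 2) ℂ) (z : ℂ × ℂ) :
    polyVal (p * q) z = polyVal p z * polyVal q z :=
  map_mul _ _ _

theorem continuous_polyVal (p : MvPolynomial (Fin 2) ℂ) : Continuous (polyVal p) := by
  have h : Continuous fun z : ℂ × ℂ => (![z.1, z.2] : Fin 2 → ℂ) := by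
    refine continuous_pi fun i => ?_
    fin_cases i
    exacts [continuous_fst, continuous_snd]
  exact (MvPolynomial.continuous_eval p).comp h

theorem bddAbove_norm_div {p q : MvPolynomial (Fin 2) ℂ}
    (hq : ∀ z ∈ closedSymmBidisc, polyVal q z ≠ 0) :
    BddAbove ((fun z => ‖polyVal p z / polyVal q z‖) '' closedSymmBidisc) :=
  (isCompact_closedSymmBidisc.image_of_continuousOn
    (((continuous_polyVal p).continuousOn.div (continuous_polyVal q).continuousOn hq).norm)).bddAbove

/-- The von Neumann inequality for `p/q`, evaluated at `q(S, P)x`, which removes the inverse. -/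
theorem IsGammaContraction.norm_polyOp_le {S P : H →L[ℂ] H} (h : IsGammaContraction S P)
    {p q : MvPolynomial (Fin 2) ℂ} (hq : ∀ z ∈ closedSymmBidisc, polyVal q z ≠ 0)
    (hpq : ∀ z ∈ closedSymmBidisc, ‖polyVal p z‖ ≤ ‖polyVal q z‖) (x : H) :
    ‖polyOp p S P x‖ ≤ ‖polyOp q S P x‖ := by
  obtain ⟨hu, hn⟩ := h.vonNeumann p q hq
  have h1 : sSup ((fun z => ‖polyVal p z / polyVal q z‖) '' closedSymmBidisc) ≤ 1 := by
    refine Real.sSup_le ?_ zero_le_one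
    rintro _ ⟨z, hz, rfl⟩
    simp only [norm_div]
    exact div_le_one_of_le₀ (hpq z hz) (norm_nonneg _)
  have e : polyOp p S P x =
      (polyOp p S P * Ring.inverse (polyOp q S P)) (polyOp q S P x) := by
    rw [← mul_apply_eq_comp, mul_assoc, Ring.inverse_mul_cancel _ hu, mul_one]
  rw [e]
  exact ((ContinuousLinearMap.le_opNorm _ _).trans
    (mul_le_mul_of_nonneg_right (hn.trans h1) (norm_nonneg _))).trans_eq (one_mul _)

theorem IsGammaContraction.norm_right_apply_le {S P : H →L[ℂ] H} (h : IsGammaContraction S P)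
    (x : H) : ‖P x‖ ≤ ‖x‖ := by
  have := h.norm_polyOp_le (p := MvPolynomial.X 1) (q := 1) (by simp [polyVal])
    (fun z hz => by simpa [polyVal] using norm_snd_le_of_mem_closedSymmBidisc hz) x
  rwa [← polyOpHom_apply h.comm, ← polyOpHom_apply h.comm, map_one, polyOpHom_X_one] at this

theorem IsGammaContraction.norm_left_apply_le {S P : H →L[ℂ] H} (h : IsGammaContraction S P)
    (x : H) : ‖S x‖ ≤ 2 * ‖x‖ := by
  have := h.norm_polyOp_le (p := MvPolynomial.X 0) (q := MvPolynomial.C 2) (by simp [polyVal])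
    (fun z hz => by simpa [polyVal] using norm_fst_le_of_mem_closedSymmBidisc hz) x
  rw [← polyOpHom_apply h.comm, ← polyOpHom_apply h.comm, polyOpHom_C, polyOpHom_X_zero] at this
  simpa [norm_smul] using this

open MvPolynomial in
-- The test function is precomposed with `(s, p) ↦ (as, a²p)`. Strictness of `|a| < 1` keeps `2 -
-- as` zero free on `Γ`; unimodular `a` are reached by a limit.
theorem IsGammaContraction.norm_two_mul_sub_apply_le_of_lt {S P : H →L[ℂ] H}
    (h : IsGammaContraction S P) {a : ℂ} (ha : ‖a‖ < 1) (x : H) :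
    ‖(2 * a ^ 2) • P x - a • S x‖ ≤ ‖(2 : ℂ) • x - a • S x‖ := by
  have := h.norm_polyOp_le (p := C (2 * a ^ 2) * X 1 - C a * X 0) (q := C 2 - C a * X 0)
    (fun z hz h0 => by
      have hz := norm_fst_le_of_mem_closedSymmBidisc hz
      simp only [polyVal, map_sub, map_mul, eval_C, eval_X, Matrix.cons_val_zero] at h0
      have h2 : ‖a * z.1‖ = 2 := by rw [← sub_eq_zero.1 h0]; simp
      rw [norm_mul] at h2
      nlinarith [norm_nonneg a, norm_nonneg z.1])
    (fun z hz => by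
      obtain ⟨w, ⟨h1, h2⟩, rfl⟩ := hz
      have := norm_two_mul_sub_le (z := a * w.1) (w := a * w.2)
        (by rw [norm_mul]; exact mul_le_one₀ ha.le (norm_nonneg _) h1)
        (by rw [norm_mul]; exact mul_le_one₀ ha.le (norm_nonneg _) h2)
      simp only [polyVal, map_sub, map_mul, eval_C, eval_X, symmMap, Matrix.cons_val_zero,
        Matrix.cons_val_one]
      convert this using 2 <;> ring) x
  rw [← polyOpHom_apply h.comm, ← polyOpHom_apply h.comm] at this
  simpa only [map_sub, map_mul, polyOpHom_C, polyOpHom_X_zero, polyOpHom_X_one, smul_mul_assoc,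
    one_mul, sub_apply, smul_apply,
    one_apply_eq_self, mul_smul] using this

theorem IsGammaContraction.norm_two_mul_sub_apply_le {S P : H →L[ℂ] H}
    (h : IsGammaContraction S P) {a : ℂ} (ha : ‖a‖ = 1) (x : H) :
    ‖(2 * a ^ 2) • P x - a • S x‖ ≤ ‖(2 : ℂ) • x - a • S x‖ := by
  have ht : Filter.Tendsto (fun r : ℝ => (r : ℂ) * a) (nhdsWithin 1 (Set.Iio 1)) (nhds a) := by
    have : Continuous fun r : ℝ => (r : ℂ) * a := by fun_prop
    have h1 := this.tendsto 1
    simp only [Complex.ofReal_one, one_mul] at h1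
    exact h1.mono_left nhdsWithin_le_nhds
  have c1 : Continuous fun a : ℂ => ‖(2 * a ^ 2) • P x - a • S x‖ := by fun_prop
  have c2 : Continuous fun a : ℂ => ‖(2 : ℂ) • x - a • S x‖ := by fun_prop
  refine le_of_tendsto_of_tendsto ((c1.tendsto a).comp ht) ((c2.tendsto a).comp ht) ?_
  have h0 : ∀ᶠ r : ℝ in nhdsWithin 1 (Set.Iio 1), 0 < r :=
    nhdsWithin_le_nhds (lt_mem_nhds one_pos)
  filter_upwards [h0, self_mem_nhdsWithin] with r hr hr1
  refine h.norm_two_mul_sub_apply_le_of_lt ?_ x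
  rw [norm_mul, ha, mul_one, Complex.norm_real, Real.norm_eq_abs, abs_of_pos hr]
  exact hr1

/-- The defining positivity property of `Γ`-contractions. -/
theorem IsGammaContraction.re_inner_le {S P : H →L[ℂ] H}
    (h : IsGammaContraction S P) {a : ℂ} (ha : ‖a‖ = 1) (x : H) :
    (a * (inner ℂ x (S x) - inner ℂ (S x) (P x))).re ≤ ‖x‖ ^ 2 - ‖P x‖ ^ 2 := by
  -- After expanding both squares the terms `‖Sx‖²` cancel.
  have h1 := pow_le_pow_left₀ (norm_nonneg _) (h.norm_two_mul_sub_apply_le ha x) 2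
  rw [@norm_sub_sq ℂ, @norm_sub_sq ℂ] at h1
  have e : (starRingEnd ℂ) a * a = 1 := by
    rw [Complex.conj_mul', ha]; norm_num
  have e1 : RCLike.re (inner ℂ ((2 * a ^ 2) • P x) (a • S x)) =
      2 * (a * inner ℂ (S x) (P x)).re := by
    rw [← inner_conj_symm, RCLike.conj_re, inner_smul_left, inner_smul_right]
    have : conj a * (2 * a ^ 2 * inner ℂ (S x) (P x)) =
      (2 : ℝ) * (a * inner ℂ (S x) (P x)) := by
      push_cast; linear_combination (2 * a * inner ℂ (S x) (P x)) * e
    rw [this]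
    exact Complex.re_ofReal_mul _ _
  have e2 : RCLike.re (inner ℂ ((2 : ℂ) • x) (a • S x)) = 2 * (a * inner ℂ x (S x)).re := by
    rw [inner_smul_left, inner_smul_right]
    have : conj (2 : ℂ) * (a * inner ℂ x (S x)) = (2 : ℝ) * (a * inner ℂ x (S x)) := by
      rw [Complex.conj_ofNat]; push_cast; rfl
    rw [this]
    exact Complex.re_ofReal_mul _ _
  rw [e1, e2] at h1
  simp only [norm_smul, norm_mul, norm_pow, ha, Complex.norm_ofNat] at h1
  rw [mul_sub, Complex.sub_re]
  nlinarith

/-- If `1 - b S + b² P` is invertible for all `b ∈ 𝔻`, then the Taylor spectrum lies in `Γ`. -/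
theorem taylorSpectrum_subset_closedSymmBidisc {S P : H →L[ℂ] H} (h : Commute S P)
    (hu : ∀ b : ℂ, ‖b‖ < 1 → IsUnit (1 - b • S + b ^ 2 • P)) :
    taylorSpectrum S P ⊆ closedSymmBidisc := by
  intro z hz
  by_contra hΓ
  refine hz ?_
  clear hz
  obtain ⟨a, c, ha, rfl⟩ := exists_eq_of_notMem_closedSymmBidisc hΓ
  have ha0 : a ≠ 0 := by rintro rfl; simp at ha; linarith
  obtain ⟨R, hR⟩ := hu a⁻¹ (by rw [norm_inv]; exact inv_lt_one_of_one_lt₀ ha)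
  set S' := S - (a + c) • (1 : H →L[ℂ] H) with hS'
  set P' := P - (a * c) • (1 : H →L[ℂ] H) with hP'
  have hc : S' * P' = P' * S' := by
    rw [hS', hP']
    simp only [sub_mul, mul_sub, h.eq, smul_mul_assoc, mul_smul_comm, one_mul, mul_one, smul_sub, smul_smul,
      mul_comm (a * c) (a + c)]
    abel
  -- At `(s, p) = (a + c, ac)` the scalar `1 - s/a + p/a²` vanishes, so `R` is a combination of `S'`
  -- and `P'` alone. Its invertibility gives a contracting homotopy of the Koszul complex.
  have hR' : (R : H →L[ℂ] H) = (a⁻¹ ^ 2) • P' - a⁻¹ • S' := by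
    rw [hR, hS', hP']
    simp only [smul_sub, smul_smul]
    have e : a⁻¹ * (a + c) = a⁻¹ ^ 2 * (a * c) + 1 := by field_simp; ring
    rw [e, add_smul, one_smul]
    abel
  have hRS : Commute (R : H →L[ℂ] H) S' := by
    rw [hR']
    exact (Commute.smul_left hc.symm _).sub_left (Commute.smul_left (Commute.refl _) _)
  have hRP : Commute (R : H →L[ℂ] H) P' := by
    rw [hR']
    exact (Commute.smul_left (Commute.refl _) _).sub_left (Commute.smul_left hc _)
  have hcx : ∀ x, S' (P' x) = P' (S' x) := fun x => DFunLike.congr_fun hc x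
  have hSi : ∀ x, S' ((↑R⁻¹ : H →L[ℂ] H) x) = (↑R⁻¹ : H →L[ℂ] H) (S' x) :=
    fun x => (DFunLike.congr_fun hRS.units_inv_left.eq x).symm
  have hPi : ∀ x, P' ((↑R⁻¹ : H →L[ℂ] H) x) = (↑R⁻¹ : H →L[ℂ] H) (P' x) :=
    fun x => (DFunLike.congr_fun hRP.units_inv_left.eq x).symm
  have hinv : ∀ x, (↑R⁻¹ : H →L[ℂ] H) ((R : H →L[ℂ] H) x) = x :=
    fun x => DFunLike.congr_fun R.inv_mul x
  have hRx : ∀ x, (R : H →L[ℂ] H) x = (a⁻¹ ^ 2) • P' x - a⁻¹ • S' x := fun x => by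
    rw [hR']; rfl
  refine ⟨fun x y hxy => ?_, fun ⟨x, y⟩ => ⟨fun h0 => ?_, ?_⟩, fun w => ?_⟩
  · obtain ⟨h1, h2⟩ := Prod.mk.inj hxy
    have h1 : S' x = S' y := h1
    have h2 : P' x = P' y := h2
    rw [← hinv x, ← hinv y, hRx, hRx, h1, h2]
  · have h0 : S' y = P' x := sub_eq_zero.1 h0
    refine ⟨(↑R⁻¹ : H →L[ℂ] H) (a⁻¹ ^ 2 • y - a⁻¹ • x), Prod.ext ?_ ?_⟩
    · change S' _ = x
      rw [hSi, map_sub, map_smul, map_smul, h0, ← hRx, hinv]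
    · change P' _ = y
      rw [hPi, map_sub, map_smul, map_smul, ← h0, ← hRx, hinv]
  · rintro ⟨w, hw⟩
    obtain ⟨h1, h2⟩ := Prod.mk.inj hw
    change S' y - P' x = 0
    have h1 : S' w = x := h1
    have h2 : P' w = y := h2
    rw [← h1, ← h2, hcx, sub_self]
  · refine ⟨(-(a⁻¹ ^ 2) • (↑R⁻¹ : H →L[ℂ] H) w, -a⁻¹ • (↑R⁻¹ : H →L[ℂ] H) w), ?_⟩
    change S' (-a⁻¹ • (↑R⁻¹ : H →L[ℂ] H) w) - P' (-(a⁻¹ ^ 2) • (↑R⁻¹ : H →L[ℂ] H) w) = w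
    rw [map_smul, map_smul]
    have e := DFunLike.congr_fun R.mul_inv w
    rw [mul_apply_eq_comp, hRx] at e
    rw [neg_smul, neg_smul, neg_sub_neg]
    exact e

end PolynomialCalculus

/-! ### Spectral radius and invertibility in Banach algebras. -/

/-- Gelfand's formula along the exponents `2ⁿ` is a constant sequence. -/
theorem spectralRadius_eq_nnnorm_of_pow_two_pow {B : Type*} [NormedRing B] [NormedAlgebra ℂ B]
    [CompleteSpace B] {a : B} (ha : ∀ n : ℕ, ‖a ^ 2 ^ n‖ = ‖a‖ ^ 2 ^ n) :
    spectralRadius ℂ a = ‖a‖₊ := by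
  have hconst : Filter.Tendsto (fun _n : ℕ => (‖a‖₊ : ENNReal)) Filter.atTop _ :=
    tendsto_const_nhds
  refine tendsto_nhds_unique ?_ hconst
  convert!
    (spectrum.pow_nnnorm_pow_one_div_tendsto_nhds_spectralRadius (a : B)).comp
      (tendsto_pow_atTop_atTop_of_one_lt one_lt_two) using 1
  refine funext fun n => ?_
  have h : ‖a ^ 2 ^ n‖₊ = ‖a‖₊ ^ 2 ^ n := NNReal.eq (by simpa using ha n)
  rw [Function.comp_apply, h, ENNReal.coe_pow, ← ENNReal.rpow_natCast, ← ENNReal.rpow_mul]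
  simp

/-- A bounded below operator on a Banach space that is a limit of invertible operators is
invertible. -/
theorem isUnit_of_mem_closure_of_bounded_below {E : Type*} [NormedAddCommGroup E]
    [NormedSpace ℂ E] [CompleteSpace E] {R : E →L[ℂ] E} {c : ℝ} (hc : 0 < c)
    (hR : ∀ x, c * ‖x‖ ≤ ‖R x‖) (h : R ∈ closure {X : E →L[ℂ] E | IsUnit X}) : IsUnit R := by
  -- At distance less than `c/2` the unit `u` is still bounded below by `c/2`, so `‖u⁻¹‖ ≤ 2/c` and
  -- `u⁻¹R` is within distance one of the identity.
  obtain ⟨_, ⟨u, rfl⟩, hu⟩ := Metric.mem_closure_iff.1 h (c / 2) (by positivity)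
  rw [dist_eq_norm] at hu
  have hb : ∀ x, c / 2 * ‖x‖ ≤ ‖(u : E →L[ℂ] E) x‖ := fun x => by
    have h1 := (R - u).le_opNorm x
    have h2 := norm_sub_norm_le (R x) ((u : E →L[ℂ] E) x)
    have h3 := hR x
    have h4 := mul_le_mul_of_nonneg_right hu.le (norm_nonneg x)
    rw [sub_apply] at h1
    linarith
  have hi : ‖(↑u⁻¹ : E →L[ℂ] E)‖ ≤ (c / 2)⁻¹ := by
    refine ContinuousLinearMap.opNorm_le_bound _ (by positivity) fun y => ?_
    have h1 := hb ((↑u⁻¹ : E →L[ℂ] E) y)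
    have h2 : (u : E →L[ℂ] E) ((↑u⁻¹ : E →L[ℂ] E) y) = y := DFunLike.congr_fun u.mul_inv y
    rw [h2] at h1
    rw [inv_mul_eq_div, le_div_iff₀ (by positivity), mul_comm]
    exact h1
  have h1 : ‖(1 : E →L[ℂ] E) - ↑u⁻¹ * R‖ < 1 := by
    have e : (1 : E →L[ℂ] E) - ↑u⁻¹ * R = ↑u⁻¹ * (↑u - R) := by
      rw [mul_sub, u.inv_mul]
    rw [e]
    calc _ ≤ ‖(↑u⁻¹ : E →L[ℂ] E)‖ * ‖(u : E →L[ℂ] E) - R‖ := norm_mul_le _ _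
      _ ≤ (c / 2)⁻¹ * ‖(u : E →L[ℂ] E) - R‖ := by gcongr
      _ < (c / 2)⁻¹ * (c / 2) := by
        rw [norm_sub_rev]; gcongr
      _ = 1 := inv_mul_cancel₀ (by positivity)
  have h2 : IsUnit ((↑u⁻¹ : E →L[ℂ] E) * R) := by
    have := (Units.oneSub _ h1).isUnit
    rwa [Units.val_oneSub, sub_sub_cancel] at this
  exact (Units.isUnit_units_mul _ _).1 h2

/-- Invertibility propagates along paths of operators that are all bounded below. -/
theorem isUnit_of_path_bounded_below {E : Type*} [NormedAddCommGroup E]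
    [NormedSpace ℂ E] [CompleteSpace E] {F : ℝ → E →L[ℂ] E} (hF : Continuous F)
    (h0 : IsUnit (F 0)) (hb : ∀ t ∈ Set.Icc (0 : ℝ) 1, ∃ c > 0, ∀ x, c * ‖x‖ ≤ ‖F t x‖) :
    IsUnit (F 1) := by
  have ho : IsOpen {X : E →L[ℂ] E | IsUnit X} := Units.isOpen
  have h1 : closure (F ⁻¹' {X | IsUnit X}) ∩ Set.Icc 0 1 ⊆ F ⁻¹' {X | IsUnit X} := by
    rintro t ⟨ht, ht1⟩
    obtain ⟨c, hc, hct⟩ := hb t ht1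
    exact isUnit_of_mem_closure_of_bounded_below hc hct
      (hF.closure_preimage_subset _ ht)
  have := (isPreconnected_Icc (a := (0 : ℝ)) (b := 1)).subset_of_closure_inter_subset
    (ho.preimage hF) ⟨0, by simp, h0⟩ h1
  exact this (by simp)

/-! ### Algebraic `Γ`-isometries are `Γ`-contractions. -/

section GammaIsometry

section

variable {H : Type*} [NormedAddCommGroup H] [InnerProductSpace ℂ H] {T V X Y : H →L[ℂ] H}

theorem bicommutant_commute (h : Commute T V) (hX : X ∈ bicommutant T V)
    (hY : Y ∈ bicommutant T V) : X * Y = Y * X :=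
  congrArg Subtype.val (bicommutant_mul_comm h ⟨X, hX⟩ ⟨Y, hY⟩)

theorem polyOp_mem_bicommutant (h : Commute T V) (q : MvPolynomial (Fin 2) ℂ) :
    polyOp q T V ∈ bicommutant T V := by
  rw [← coe_aeval_bicommutant h]
  exact Subtype.property _

end

variable {H : Type*} [NormedAddCommGroup H] [InnerProductSpace ℂ H] [CompleteSpace H]

/-- A `Γ`-isometry in algebraic form: a commuting pair with `V` isometric and `T = T* V`. -/
structure IsAlgGammaIsometry (T V : H →L[ℂ] H) : Prop where
  comm : Commute T V
  isometry : star V * V = 1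
  eq_star_mul : T = star T * V

theorem star_pow_mul_pow {V : H →L[ℂ] H} (hV : star V * V = 1) (n : ℕ) :
    star V ^ n * V ^ n = 1 := by
  induction n with
  | zero => simp
  | succ n ih =>
    rw [pow_succ, pow_succ', mul_assoc, ← mul_assoc (star V) V, hV, one_mul, ih]

/-- `Y` is a reversal of degree `n` of `X`: on the distinguished boundary, `Y = X̄ Vⁿ`. -/
def IsReversal (T V : H →L[ℂ] H) (n : ℕ) (X Y : H →L[ℂ] H) : Prop :=
  Y ∈ bicommutant T V ∧ X = star Y * V ^ n

variable {T V X Y X' Y' : H →L[ℂ] H} {n m : ℕ}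

theorem IsReversal.succ (h : IsAlgGammaIsometry T V) (hX : IsReversal T V n X X') :
    IsReversal T V (n + 1) X (V * X') := by
  refine ⟨mul_mem (right_mem_bicommutant T V) hX.1, ?_⟩
  rw [star_mul, pow_succ', mul_assoc, ← mul_assoc (star V) V, h.isometry, one_mul, hX.2]

theorem IsReversal.exists_of_le (h : IsAlgGammaIsometry T V) (hX : IsReversal T V n X X')
    (hn : n ≤ m) : ∃ Y', IsReversal T V m X Y' := by
  induction m, hn using Nat.le_induction with
  | base => exact ⟨_, hX⟩
  | succ m _ ih => exact ih.elim fun Z hZ => ⟨_, hZ.succ h⟩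

theorem IsReversal.mul (h : IsAlgGammaIsometry T V) (hmX : X ∈ bicommutant T V)
    (hmY : Y ∈ bicommutant T V) (hX : IsReversal T V n X X') (hY : IsReversal T V m Y Y') :
    IsReversal T V (n + m) (X * Y) (X' * Y') := by
  refine ⟨mul_mem hX.1 hY.1, ?_⟩
  have hc := bicommutant_commute h.comm hmX (pow_mem (right_mem_bicommutant T V) m)
  rw [bicommutant_commute h.comm hmX hmY, star_mul, pow_add, mul_assoc (star Y'),
    ← mul_assoc (star X'), ← hX.2, hc, ← mul_assoc, ← hY.2]

/-- Reversals are closed under sums (after equalizing degrees) and products. On generators, `T =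
T*V` says that `T` is its own reversal of degree one, and `1` is a reversal of `V`. -/
theorem exists_isReversal_polyOp (h : IsAlgGammaIsometry T V) (q : MvPolynomial (Fin 2) ℂ) :
    ∃ n Y, IsReversal T V n (polyOp q T V) Y := by
  simp only [← polyOpHom_apply h.comm]
  induction q using MvPolynomial.induction_on with
  | C c =>
    refine ⟨0, conj c • 1, Subalgebra.smul_mem _ (one_mem _) _, ?_⟩
    rw [polyOpHom_C]
    simp
  | add p q hp hq =>
    obtain ⟨n, X', hX⟩ := hp
    obtain ⟨m, Y', hY⟩ := hq
    obtain ⟨X', hX⟩ := hX.exists_of_le h (le_max_left n m)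
    obtain ⟨Y', hY⟩ := hY.exists_of_le h (le_max_right n m)
    refine ⟨max n m, X' + Y', add_mem hX.1 hY.1, ?_⟩
    rw [map_add, star_add, add_mul, ← hX.2, ← hY.2]
  | mul_X p i hp =>
    obtain ⟨n, X', hX⟩ := hp
    have hm : polyOpHom h.comm p ∈ bicommutant T V := by
      rw [polyOpHom_apply]; exact polyOp_mem_bicommutant h.comm p
    have hi : i = 0 ∨ i = 1 := by fin_cases i <;> simp
    rw [map_mul]
    rcases hi with rfl | rfl
    · rw [polyOpHom_X_zero]
      exact ⟨_, _, hX.mul h hm (left_mem_bicommutant T V)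
        (m := 1) (Y' := T) ⟨left_mem_bicommutant T V, by rw [pow_one]; exact h.eq_star_mul⟩⟩
    · rw [polyOpHom_X_one]
      exact ⟨_, _, hX.mul h hm (right_mem_bicommutant T V)
        (m := 1) (Y' := 1) ⟨one_mem _, by simp⟩⟩

theorem IsReversal.star_eq (hX : IsReversal T V n X X') : star X = star V ^ n * X' := by
  rw [hX.2, star_mul, star_star, star_pow]

theorem IsReversal.symm (h : IsAlgGammaIsometry T V) (hX : IsReversal T V n X X') :
    X' = star X * V ^ n := by
  rw [hX.star_eq, mul_assoc, bicommutant_commute h.comm hX.1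
    (pow_mem (right_mem_bicommutant T V) n), ← mul_assoc, star_pow_mul_pow h.isometry, one_mul]

theorem norm_sq_eq_re_inner_star_mul (X : H →L[ℂ] H) (x : H) :
    ‖X x‖ ^ 2 = (inner ℂ x ((star X * X) x)).re :=
  X.apply_norm_sq_eq_inner_adjoint_right x

theorem IsReversal.norm_apply (h : IsAlgGammaIsometry T V) (hm : X ∈ bicommutant T V)
    (hX : IsReversal T V n X X') (x : H) : ‖X' x‖ = ‖X x‖ := by
  refine (sq_eq_sq₀ (norm_nonneg _) (norm_nonneg _)).1 ?_
  have e : star X' * X' = star X * X := by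
    have e1 : star X' = star V ^ n * X := by
      rw [hX.symm h, star_mul, star_star, star_pow]
    rw [e1, hX.star_eq, mul_assoc, mul_assoc, bicommutant_commute h.comm hm hX.1]
  rw [norm_sq_eq_re_inner_star_mul, e, ← norm_sq_eq_re_inner_star_mul]

/-- Products of polynomials in a `Γ`-isometry satisfy a Cauchy-Schwarz inequality. -/
theorem IsReversal.norm_mul_apply_sq_le (h : IsAlgGammaIsometry T V) (hmX : X ∈ bicommutant T V)
    (hmY : Y ∈ bicommutant T V) (hX : IsReversal T V n X X') (hY : IsReversal T V n Y Y')
    (x : H) : ‖(X * Y) x‖ ^ 2 ≤ ‖(X * X) x‖ * ‖(Y * Y) x‖ := by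
  have c := fun {A B : H →L[ℂ] H} => bicommutant_commute (X := A) (Y := B) h.comm
  have e : star (X * Y) * (X * Y) = star (Y' * Y) * (X' * X) := by
    have e1 : star Y' = star V ^ n * Y := by
      rw [hY.symm h, star_mul, star_star, star_pow]
    rw [star_mul, star_mul, hX.star_eq, e1]
    simp only [mul_assoc]
    rw [← mul_assoc Y X' X, c hmY hX.1, mul_assoc X' Y X, c hmY hmX]
  have e2 : ‖(X * Y) x‖ ^ 2 = (inner ℂ ((Y' * Y) x) ((X' * X) x)).re := by
    rw [norm_sq_eq_re_inner_star_mul, e, ContinuousLinearMap.star_eq_adjoint, mul_apply_eq_comp,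
      ContinuousLinearMap.adjoint_inner_right]
  rw [e2]
  refine (Complex.re_le_norm _).trans ((norm_inner_le_norm _ _).trans_eq ?_)
  rw [mul_apply_eq_comp, mul_apply_eq_comp, hX.norm_apply h hmX, hY.norm_apply h hmY, mul_comm]
  rfl

theorem norm_polyOp_mul_apply_sq_le (h : IsAlgGammaIsometry T V) (p q : MvPolynomial (Fin 2) ℂ)
    (x : H) : ‖polyOp (p * q) T V x‖ ^ 2 ≤ ‖polyOp (p * p) T V x‖ * ‖polyOp (q * q) T V x‖ := by
  obtain ⟨n, X', hX⟩ := exists_isReversal_polyOp h p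
  obtain ⟨m, Y', hY⟩ := exists_isReversal_polyOp h q
  obtain ⟨X', hX⟩ := hX.exists_of_le h (le_max_left n m)
  obtain ⟨Y', hY⟩ := hY.exists_of_le h (le_max_right n m)
  rw [polyOp_mul h.comm, polyOp_mul h.comm, polyOp_mul h.comm]
  exact hX.norm_mul_apply_sq_le h (polyOp_mem_bicommutant h.comm _)
    (polyOp_mem_bicommutant h.comm _) hY x

/-- Here `W` is `p(T, V) q(T, V)⁻¹`. The Cauchy-Schwarz inequality at the vector `q(T, V)⁻²k` reads
`‖Wk‖² ≤ ‖W²k‖ ‖k‖`. -/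
theorem norm_sq_le_of_polyOp_eq_mul (h : IsAlgGammaIsometry T V) {p q : MvPolynomial (Fin 2) ℂ}
    (hq : IsUnit (polyOp q T V)) {W : H →L[ℂ] H} (hW : polyOp p T V = W * polyOp q T V)
    (hc : Commute W (polyOp q T V)) : ‖W‖ ^ 2 ≤ ‖W ^ 2‖ := by
  have hk : ∀ k, ‖W k‖ ^ 2 ≤ ‖W ^ 2‖ * ‖k‖ ^ 2 := fun k => by
    obtain ⟨u, hu⟩ := hq.mul hq
    set m := (↑u⁻¹ : H →L[ℂ] H) k
    have hm : (polyOp q T V * polyOp q T V) m = k := by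
      rw [← hu]
      exact DFunLike.congr_fun u.mul_inv k
    have h1 := norm_polyOp_mul_apply_sq_le h p q m
    rw [polyOp_mul h.comm, polyOp_mul h.comm, polyOp_mul h.comm, hm] at h1
    have e1 : (polyOp p T V * polyOp q T V) m = W k := by
      rw [hW, mul_assoc, mul_apply_eq_comp, ← hm]
    have e2 : (polyOp p T V * polyOp p T V) m = (W ^ 2) k := by
      have : polyOp p T V * polyOp p T V = W ^ 2 * (polyOp q T V * polyOp q T V) := by
        rw [hW, mul_assoc W, ← mul_assoc _ W, ← hc.eq, pow_two]
        simp only [mul_assoc]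
      rw [this, mul_apply_eq_comp, ← hm]
    rw [e1, e2] at h1
    calc _ ≤ _ := h1
      _ ≤ ‖W ^ 2‖ * ‖k‖ * ‖k‖ := by gcongr; exact ContinuousLinearMap.le_opNorm _ _
      _ = _ := by ring
  have h2 : ‖W‖ ≤ √‖W ^ 2‖ := by
    refine ContinuousLinearMap.opNorm_le_bound _ (Real.sqrt_nonneg _) fun k => ?_
    refine le_of_sq_le_sq ?_ (by positivity)
    rw [mul_pow, Real.sq_sqrt (norm_nonneg _)]
    exact hk k
  calc ‖W‖ ^ 2 ≤ √‖W ^ 2‖ ^ 2 := by gcongr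
    _ = _ := Real.sq_sqrt (norm_nonneg _)

theorem norm_pow_two_pow_of_polyOp_eq_mul (h : IsAlgGammaIsometry T V)
    {p q : MvPolynomial (Fin 2) ℂ}
    (hq : IsUnit (polyOp q T V)) {W : H →L[ℂ] H} (hW : polyOp p T V = W * polyOp q T V)
    (hc : Commute W (polyOp q T V)) (n : ℕ) : ‖W ^ 2 ^ n‖ = ‖W‖ ^ 2 ^ n := by
  induction n generalizing p q W with
  | zero => simp
  | succ n ih =>
    -- `W²` is again of the same form, with `p²` and `q²`, so the norm identity can be iterated.
    have h1 := ih (p := p * p) (q := q * q) (W := W ^ 2)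
      (by rw [polyOp_mul h.comm]; exact hq.mul hq)
      (by
        rw [polyOp_mul h.comm, polyOp_mul h.comm, hW, mul_assoc W, ← mul_assoc _ W, ← hc.eq, pow_two]
        simp only [mul_assoc])
      (by rw [polyOp_mul h.comm]; exact (hc.mul_right hc).pow_left 2)
    have h2 : ‖W ^ 2‖ = ‖W‖ ^ 2 :=
      le_antisymm (by rw [pow_two, pow_two]; exact norm_mul_le _ _)
        (norm_sq_le_of_polyOp_eq_mul h hq hW hc)
    rw [pow_succ', pow_mul, h1, h2, ← pow_mul]

/-- An algebraic `Γ`-isometry such that `1 - b T + b² V` is invertible for all `b ∈ 𝔻` is a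
`Γ`-contraction. -/
theorem IsAlgGammaIsometry.isGammaContraction (h : IsAlgGammaIsometry T V)
    (hu : ∀ b : ℂ, ‖b‖ < 1 → IsUnit (1 - b • T + b ^ 2 • V)) : IsGammaContraction T V := by
  refine ⟨h.comm, taylorSpectrum_subset_closedSymmBidisc h.comm hu, fun p q hq => ?_⟩
  let _ := bicommutantNormedCommRing h.comm
  let _ : NormedAlgebra ℂ (bicommutant T V) := Subalgebra.toNormedAlgebra _
  have : CompleteSpace (bicommutant T V) := (isClosed_bicommutant T V).completeSpace_coe
  set t : bicommutant T V := ⟨T, left_mem_bicommutant T V⟩ with ht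
  set v : bicommutant T V := ⟨V, right_mem_bicommutant T V⟩ with hv
  -- Were `(χ T, χ V) = (a + c, ac)` with `|a| > 1`, then `χ` would kill the unit `1 - a⁻¹T + a⁻²V`.
  have hmem : ∀ χ : WeakDual.characterSpace ℂ (bicommutant T V),
      (χ t, χ v) ∈ closedSymmBidisc := fun χ => by
    by_contra hΓ
    obtain ⟨a, c, ha, he⟩ := exists_eq_of_notMem_closedSymmBidisc hΓ
    obtain ⟨e1, e2⟩ := Prod.mk.inj he
    have ha0 : a ≠ 0 := by rintro rfl; simp at ha; linarith
    have h1 : IsUnit (1 - a⁻¹ • t + a⁻¹ ^ 2 • v) := by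
      rw [isUnit_bicommutant_iff]
      exact hu a⁻¹ (by rw [norm_inv]; exact inv_lt_one_of_one_lt₀ ha)
    have h2 := h1.map χ
    rw [map_add, map_sub, map_smul, map_smul, map_one, e1, e2, smul_eq_mul, smul_eq_mul] at h2
    refine h2.ne_zero ?_
    field_simp
    ring
  have hχ : ∀ (χ : WeakDual.characterSpace ℂ (bicommutant T V)) (f : MvPolynomial (Fin 2) ℂ),
      χ (MvPolynomial.aeval ![t, v] f) = polyVal f (χ t, χ v) := fun χ f => by
    have h1 := AlgHom.congr_fun
      (MvPolynomial.comp_aeval ![t, v] (WeakDual.CharacterSpace.toAlgHom χ)) f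
    have h2 : (fun i => WeakDual.CharacterSpace.toAlgHom χ ((![t, v] : Fin 2 → _) i)) =
        ![χ t, χ v] := by
      funext i; fin_cases i <;> rfl
    rw [h2] at h1
    exact h1.trans (DFunLike.congr_fun (MvPolynomial.coe_aeval_eq_eval ![χ t, χ v]) f)
  have hcoe : ∀ f : MvPolynomial (Fin 2) ℂ,
      ((MvPolynomial.aeval ![t, v] f : bicommutant T V) : H →L[ℂ] H) = polyOp f T V :=
    coe_aeval_bicommutant h.comm
  have hqu : IsUnit (MvPolynomial.aeval ![t, v] q : bicommutant T V) := by
    by_contra hn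
    obtain ⟨χ, h0⟩ := WeakDual.CharacterSpace.exists_apply_eq_zero hn
    rw [hχ] at h0
    exact hq _ (hmem χ) h0
  have hqu' : IsUnit (polyOp q T V) := by
    rw [← hcoe, ← isUnit_bicommutant_iff]; exact hqu
  refine ⟨hqu', ?_⟩
  obtain ⟨u, hu'⟩ := hqu
  set w : bicommutant T V := MvPolynomial.aeval ![t, v] p * ↑u⁻¹ with hw
  have hwq : w * MvPolynomial.aeval ![t, v] q = MvPolynomial.aeval ![t, v] p := by
    rw [hw, ← hu', Units.inv_mul_cancel_right]
  have hwq' : polyOp p T V = w * polyOp q T V := by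
    rw [← hcoe, ← hcoe, ← hwq]; rfl
  have hW : polyOp p T V * Ring.inverse (polyOp q T V) = w := by
    rw [hwq', mul_assoc, Ring.mul_inverse_cancel _ hqu', mul_one]
  rw [hW]
  -- Attaining the spectral radius requires a nonempty spectrum, so `H = 0` is separated.
  rcases subsingleton_or_nontrivial H with hs | hs
  · have : (w : H →L[ℂ] H) = 0 := Subsingleton.elim _ _
    rw [this, norm_zero]
    refine Real.sSup_nonneg ?_
    rintro _ ⟨z, -, rfl⟩
    exact norm_nonneg _
  have hnt : Nontrivial (bicommutant T V) := inferInstance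
  have hr : spectralRadius ℂ w = ‖w‖₊ := by
    refine spectralRadius_eq_nnnorm_of_pow_two_pow fun n => ?_
    exact norm_pow_two_pow_of_polyOp_eq_mul h hqu' hwq'
      (bicommutant_commute h.comm w.2 (polyOp_mem_bicommutant h.comm q)) n
  obtain ⟨μ, hμ, hμr⟩ := spectrum.exists_nnnorm_eq_spectralRadius w
  rw [hr, ENNReal.coe_inj] at hμr
  obtain ⟨χ, rfl⟩ := WeakDual.CharacterSpace.mem_spectrum_iff_exists.1 hμ
  have e1 : ‖(w : H →L[ℂ] H)‖ = ‖χ w‖ := (congrArg NNReal.toReal hμr).symm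
  have e2 : χ w = polyVal p (χ t, χ v) / polyVal q (χ t, χ v) := by
    rw [eq_div_iff (hq _ (hmem χ)), ← hχ, ← hχ, ← map_mul, hwq]
  rw [e1, e2]
  exact le_csSup (bddAbove_norm_div hq) ⟨_, hmem χ, rfl⟩

end GammaIsometry

/-! ### The defect form and the fundamental operator. -/

section FundamentalOperator

variable {H : Type*} [NormedAddCommGroup H] [InnerProductSpace ℂ H] [CompleteSpace H]
  {S P : H →L[ℂ] H} {A : defectSpace P →L[ℂ] defectSpace P}

theorem one_sub_star_mul_self_nonneg (hP : ∀ x, ‖P x‖ ≤ ‖x‖) :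
    0 ≤ 1 - ContinuousLinearMap.adjoint P * P := by
  rw [ContinuousLinearMap.nonneg_iff_isPositive, ContinuousLinearMap.isPositive_def']
  refine ⟨?_, fun x => ?_⟩
  · exact (IsSelfAdjoint.one _).sub (IsSelfAdjoint.star_mul_self P)
  · have h := pow_le_pow_left₀ (norm_nonneg _) (hP x) 2
    rw [ContinuousLinearMap.reApplyInnerSelf_apply, sub_apply, inner_sub_left, map_sub,
      one_apply_eq_self, mul_apply_eq_comp, ContinuousLinearMap.adjoint_inner_left,
      inner_self_eq_norm_sq, inner_self_eq_norm_sq]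
    linarith

theorem adjoint_defectOp (P : H →L[ℂ] H) :
    ContinuousLinearMap.adjoint (defectOp P) = defectOp P :=
  (IsSelfAdjoint.of_nonneg (CFC.sqrt_nonneg _)).star_eq

theorem inner_defectOpTo (hP : ∀ x, ‖P x‖ ≤ ‖x‖) (x y : H) :
    inner ℂ (defectOpTo P x) (defectOpTo P y) = inner ℂ x y - inner ℂ (P x) (P y) := by
  have e : defectOp P (defectOp P y) = y - ContinuousLinearMap.adjoint P (P y) :=
    DFunLike.congr_fun (CFC.sqrt_mul_sqrt_self _ (one_sub_star_mul_self_nonneg hP)) y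
  change inner ℂ (defectOp P x) (defectOp P y) = _
  rw [← ContinuousLinearMap.adjoint_inner_right, adjoint_defectOp, e, inner_sub_right,
    ContinuousLinearMap.adjoint_inner_right]

theorem denseRange_defectOpTo (P : H →L[ℂ] H) : DenseRange (defectOpTo P) := by
  intro y
  rw [Topology.IsEmbedding.subtypeVal.closure_eq_preimage_closure_image]
  refine closure_mono ?_ y.2
  rintro _ ⟨x, rfl⟩
  exact ⟨_, ⟨x, rfl⟩, rfl⟩

theorem IsFundamentalOperator.inner_eq (hA : IsFundamentalOperator S P A) (x y : H) :
    inner ℂ (defectOpTo P x) (A (defectOpTo P y)) = inner ℂ x (S y) - inner ℂ (S x) (P y) := by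
  have e : S y - ContinuousLinearMap.adjoint S (P y) =
      defectOp P (A (defectOpTo P y) : H) := DFunLike.congr_fun hA y
  change inner ℂ (defectOp P x) ((A (defectOpTo P y) : defectSpace P) : H) = _
  rw [← ContinuousLinearMap.adjoint_inner_right, adjoint_defectOp, ← e, inner_sub_right,
    ContinuousLinearMap.adjoint_inner_right]

/-- The numerical radius of the fundamental operator is at most one. -/
theorem IsFundamentalOperator.norm_inner_le (hA : IsFundamentalOperator S P A)
    (h : IsGammaContraction S P) (y : defectSpace P) : ‖inner ℂ y (A y)‖ ≤ ‖y‖ ^ 2 := by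
  have h1 : ∀ a : ℂ, ‖a‖ = 1 → (a * inner ℂ y (A y)).re ≤ ‖y‖ ^ 2 := fun a ha => by
    refine (denseRange_defectOpTo P).induction_on
      (p := fun y => (a * inner ℂ y (A y)).re ≤ ‖y‖ ^ 2) y ?_ fun x => ?_
    · exact isClosed_le (Complex.continuous_re.comp (by fun_prop)) (by fun_prop)
    · have h2 := h.re_inner_le ha x
      have h3 := inner_defectOpTo h.norm_right_apply_le x x
      rw [inner_self_eq_norm_sq_to_K, inner_self_eq_norm_sq_to_K,
        inner_self_eq_norm_sq_to_K] at h3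
      have h4 : ‖defectOpTo P x‖ ^ 2 = ‖x‖ ^ 2 - ‖P x‖ ^ 2 := by exact_mod_cast h3
      rwa [hA.inner_eq, h4]
  set z := inner ℂ y (A y)
  rcases eq_or_ne z 0 with hz | hz
  · rw [hz, norm_zero]; positivity
  have hn : (‖z‖ : ℂ) ≠ 0 := by simpa using hz
  -- This rotation turns `z` into `|z|`.
  have h2 := h1 (conj z / ‖z‖) (by simp [hz])
  have e : conj z / ‖z‖ * z = ‖z‖ := by
    rw [div_mul_eq_mul_div, Complex.conj_mul']
    field_simp
  rwa [e, Complex.ofReal_re] at h2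

/-- Both sides are tested against the dense range of `D_P`, where the inner products become forms in
`S` and `P`. This identity is exactly the zeroth `ℓ²` coordinate of `T_A V₀ = V₀ T_A`. -/
theorem IsFundamentalOperator.defectOpTo_apply (hA : IsFundamentalOperator S P A)
    (h : IsGammaContraction S P) (x : H) : defectOpTo P (S x) =
      A (defectOpTo P x) + ContinuousLinearMap.adjoint A (defectOpTo P (P x)) := by
  refine (denseRange_defectOpTo P).eq_of_inner_right ℂ fun y => ?_
  have hc : P (S x) = S (P x) := (DFunLike.congr_fun h.comm.eq x).symm
  rw [inner_add_right, inner_defectOpTo h.norm_right_apply_le, hA.inner_eq,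
    ContinuousLinearMap.adjoint_inner_right, ← inner_conj_symm (A _), hA.inner_eq, map_sub,
    inner_conj_symm, inner_conj_symm, hc]
  ring

end FundamentalOperator

/-! ### The pair `(T_A, V₀)` is a `Γ`-contraction. -/

section DilationPair

variable {H : Type*} [NormedAddCommGroup H] [InnerProductSpace ℂ H] [CompleteSpace H]
  {S P : H →L[ℂ] H} {A : defectSpace P →L[ℂ] defectSpace P}

theorem DilationSpace.ext {k k' : DilationSpace P} (h0 : k.fst = k'.fst)
    (h : ∀ n, k.snd n = k'.snd n) : k = k' :=
  WithLp.ofLp_injective 2 (Prod.ext h0 (lp.ext (funext h)))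

theorem commute_dilation (hA : IsFundamentalOperator S P A) (h : IsGammaContraction S P) :
    Commute (dilationT S P A) (dilationV P) := by
  refine ContinuousLinearMap.ext fun k => DilationSpace.ext ?_ fun n => ?_
  · exact DFunLike.congr_fun h.comm.eq k.fst
  · rw [mul_apply_eq_comp, mul_apply_eq_comp]
    rcases n with _ | _ | n
    · rw [dilationT_apply_snd_zero, dilationV_apply_snd_zero, dilationV_apply_snd_zero,
        dilationV_apply_fst, dilationT_apply_fst, hA.defectOpTo_apply h, add_comm]
    · rw [dilationT_apply_snd_succ, dilationV_apply_snd_zero, dilationV_apply_snd_succ,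
        dilationV_apply_snd_succ, dilationT_apply_snd_zero]
    · rw [dilationT_apply_snd_succ, dilationV_apply_snd_succ, dilationV_apply_snd_succ,
        dilationV_apply_snd_succ, dilationT_apply_snd_succ]

theorem norm_dilationV_apply (hP : ∀ x, ‖P x‖ ≤ ‖x‖) (k : DilationSpace P) :
    ‖dilationV P k‖ = ‖k‖ := by
  refine (sq_eq_sq₀ (norm_nonneg _) (norm_nonneg _)).1 ?_
  have h3 := inner_defectOpTo hP k.fst k.fst
  rw [inner_self_eq_norm_sq_to_K, inner_self_eq_norm_sq_to_K, inner_self_eq_norm_sq_to_K] at h3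
  have h4 : ‖defectOpTo P k.fst‖ ^ 2 = ‖k.fst‖ ^ 2 - ‖P k.fst‖ ^ 2 := by exact_mod_cast h3
  have h5 : ‖(dilationV P k).snd‖ ^ 2 = ‖defectOpTo P k.fst‖ ^ 2 + ‖k.snd‖ ^ 2 := by
    rw [EllTwo.norm_sq]
    exact (EllTwo.hasSum_cons (defectOpTo P k.fst) k.snd).tsum_eq
  rw [WithLp.prod_norm_sq_eq_of_L2, WithLp.prod_norm_sq_eq_of_L2, h5, h4, dilationV_apply_fst]
  ring

theorem inner_dilationT (hA : IsFundamentalOperator S P A) (k l : DilationSpace P) :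
    inner ℂ (dilationT S P A k) l = inner ℂ (dilationV P k) (dilationT S P A l) := by
  rw [WithLp.prod_inner_apply, WithLp.prod_inner_apply]
  change inner ℂ (dilationT S P A k).fst l.fst + inner ℂ (dilationT S P A k).snd l.snd =
    inner ℂ (dilationV P k).fst (dilationT S P A l).fst +
      inner ℂ (dilationV P k).snd (dilationT S P A l).snd
  have s1 := lp.summable_inner (𝕜 := ℂ) (dilationT S P A k).snd l.snd
  have s2 := lp.summable_inner (𝕜 := ℂ) (dilationV P k).snd (dilationT S P A l).snd
  have s3 : Summable fun n => inner ℂ (A (k.snd n)) (l.snd n) :=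
    lp.summable_inner (𝕜 := ℂ) (ellTwoDiag A k.snd) l.snd
  rw [lp.inner_eq_tsum, lp.inner_eq_tsum, s1.tsum_eq_zero_add, s2.tsum_eq_zero_add]
  have s1' := (summable_nat_add_iff 1).2 s1
  have s2' := (summable_nat_add_iff 1).2 s2
  have s3' := (summable_nat_add_iff 1).2 s3
  -- The coordinatewise differences telescope; their sum `⟨A k₀, l₀⟩` cancels against the zeroth
  -- coordinate.
  have e : ∀ n, inner ℂ ((dilationV P k).snd (n + 1)) ((dilationT S P A l).snd (n + 1)) -
      inner ℂ ((dilationT S P A k).snd (n + 1)) (l.snd (n + 1)) =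
      inner ℂ (A (k.snd n)) (l.snd n) - inner ℂ (A (k.snd (n + 1))) (l.snd (n + 1)) := fun n => by
    rw [dilationV_apply_snd_succ, dilationT_apply_snd_succ, dilationT_apply_snd_succ,
      inner_add_left, inner_add_right, ContinuousLinearMap.adjoint_inner_left,
      ContinuousLinearMap.adjoint_inner_right]
    ring
  have e2 := s2'.tsum_sub s1'
  rw [tsum_congr e, s3.tsum_sub s3', s3.tsum_eq_zero_add] at e2
  rw [dilationT_apply_snd_zero, dilationT_apply_snd_zero, dilationV_apply_snd_zero,
    dilationT_apply_fst, dilationT_apply_fst, dilationV_apply_fst, inner_add_left,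
    inner_add_right, ContinuousLinearMap.adjoint_inner_left,
    ContinuousLinearMap.adjoint_inner_right, ← inner_conj_symm (A (defectOpTo P k.fst)),
    hA.inner_eq, map_sub, inner_conj_symm, inner_conj_symm]
  linear_combination e2

theorem isAlgGammaIsometry_dilation (hA : IsFundamentalOperator S P A)
    (h : IsGammaContraction S P) : IsAlgGammaIsometry (dilationT S P A) (dilationV P) where
  comm := commute_dilation hA h
  isometry := ((dilationV P).norm_map_iff_adjoint_comp_self).1
    (norm_dilationV_apply h.norm_right_apply_le)
  eq_star_mul := by
    refine ContinuousLinearMap.ext fun k => ext_inner_right ℂ fun l => ?_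
    rw [inner_dilationT hA, mul_apply_eq_comp, ContinuousLinearMap.star_eq_adjoint,
      ContinuousLinearMap.adjoint_inner_left]

/-- The numerical range of `A + pA*` lies in the disc of radius two, so `s` is at distance at least
`|s| - 2` from it. -/
theorem mul_norm_le_norm_of_inner {E : Type*} [NormedAddCommGroup E] [InnerProductSpace ℂ E]
    [CompleteSpace E] {A : E →L[ℂ] E} (hw : ∀ y, ‖inner ℂ y (A y)‖ ≤ ‖y‖ ^ 2) {s p : ℂ}
    (hp : ‖p‖ = 1) (y : E) :
    (‖s‖ - 2) * ‖y‖ ≤ ‖A y + p • ContinuousLinearMap.adjoint A y - s • y‖ := by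
  rcases eq_or_ne y 0 with rfl | hy
  · simp
  have hy' : 0 < ‖y‖ := norm_pos_iff.2 hy
  have h1 := norm_inner_le_norm (𝕜 := ℂ) y (A y + p • ContinuousLinearMap.adjoint A y - s • y)
  have e : inner ℂ y (A y + p • ContinuousLinearMap.adjoint A y - s • y) =
      inner ℂ y (A y) + p * conj (inner ℂ y (A y)) - s * (‖y‖ : ℂ) ^ 2 := by
    rw [inner_sub_right, inner_add_right, inner_smul_right, inner_smul_right,
      ContinuousLinearMap.adjoint_inner_right, inner_conj_symm, inner_self_eq_norm_sq_to_K]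
    rfl
  have h2 : ‖inner ℂ y (A y) + p * conj (inner ℂ y (A y))‖ ≤ 2 * ‖y‖ ^ 2 := by
    refine (norm_add_le _ _).trans ?_
    rw [norm_mul, hp, RCLike.norm_conj]
    linarith [hw y]
  have h3 := norm_sub_norm_le (s * (‖y‖ : ℂ) ^ 2) (inner ℂ y (A y) + p * conj (inner ℂ y (A y)))
  rw [norm_sub_rev, ← e, norm_mul, norm_pow, Complex.norm_real, norm_norm] at h3
  refine le_of_mul_le_mul_left ?_ hy'
  nlinarith

theorem mul_norm_le_norm_ellTwoDiag {E : Type*} [NormedAddCommGroup E] [InnerProductSpace ℂ E]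
    {M : E →L[ℂ] E} {c : ℝ} (hc : 0 ≤ c) (hM : ∀ y, c * ‖y‖ ≤ ‖M y‖) (e : EllTwo E) :
    c * ‖e‖ ≤ ‖ellTwoDiag M e‖ := by
  refine le_of_sq_le_sq ?_ (norm_nonneg _)
  rw [mul_pow, EllTwo.norm_sq, EllTwo.norm_sq, ← tsum_mul_left]
  refine Summable.tsum_le_tsum (fun n => ?_) ((EllTwo.summable_sq e).mul_left _)
    (EllTwo.summable_diag M e)
  rw [← mul_pow]
  exact pow_le_pow_left₀ (by positivity) (hM _) 2

/-- The pair `(T_A, V₀)` has no approximate joint eigenvalues `(s, p)` with `|p| = 1`, `|s| > 2`. -/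
theorem dilation_joint_bounded_below (hA : IsFundamentalOperator S P A)
    (h : IsGammaContraction S P) {s p : ℂ} (hs : 2 < ‖s‖) (hp : ‖p‖ = 1) (k : DilationSpace P) :
    (‖s‖ - 2) * ‖k‖ ≤ 2 * ‖dilationT S P A k - s • k‖ +
      ‖ellTwoDiag (ContinuousLinearMap.adjoint A)‖ * ‖dilationV P k - p • k‖ := by
  have hf : ∀ l : DilationSpace P, ‖l.fst‖ ≤ ‖l‖ := fun l => by
    refine le_of_sq_le_sq ?_ (norm_nonneg _)
    rw [WithLp.prod_norm_sq_eq_of_L2]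
    nlinarith [sq_nonneg ‖l.snd‖]
  have hg : ∀ l : DilationSpace P, ‖l.snd‖ ≤ ‖l‖ := fun l => by
    refine le_of_sq_le_sq ?_ (norm_nonneg _)
    rw [WithLp.prod_norm_sq_eq_of_L2]
    nlinarith [sq_nonneg ‖l.fst‖]
  have hk : ‖k‖ ≤ ‖k.fst‖ + ‖k.snd‖ := by
    refine le_of_sq_le_sq ?_ (by positivity)
    rw [WithLp.prod_norm_sq_eq_of_L2]
    nlinarith [norm_nonneg k.fst, norm_nonneg k.snd]
  have h1 : (‖s‖ - 2) * ‖k.fst‖ ≤ ‖dilationT S P A k - s • k‖ := by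
    refine le_trans ?_ (hf _)
    change _ ≤ ‖S k.fst - s • k.fst‖
    have h2 := norm_sub_norm_le (s • k.fst) (S k.fst)
    rw [norm_sub_rev, norm_smul] at h2
    linarith [h.norm_left_apply_le k.fst]
  have h2 : (‖s‖ - 2) * ‖k.snd‖ ≤ ‖dilationT S P A k - s • k‖ +
      ‖ellTwoDiag (ContinuousLinearMap.adjoint A)‖ * ‖dilationV P k - p • k‖ := by
    -- In every coordinate, the zeroth included, `T_A k` is `A*` of `V₀ k` plus `A k`. Where `V₀` is
    -- nearly `p`, `T_A` thus acts nearly as the diagonal operator `A + pA*`.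
    have e : ellTwoDiag (A + p • ContinuousLinearMap.adjoint A - s • 1) k.snd =
        (dilationT S P A k - s • k).snd -
          ellTwoDiag (ContinuousLinearMap.adjoint A) (dilationV P k - p • k).snd := by
      refine lp.ext (funext fun n => ?_)
      change A (k.snd n) + p • ContinuousLinearMap.adjoint A (k.snd n) - s • k.snd n =
        ((dilationT S P A k).snd n - s • k.snd n) -
          ContinuousLinearMap.adjoint A ((dilationV P k).snd n - p • k.snd n)
      rw [map_sub, map_smul]
      cases n with
      | zero => rw [dilationT_apply_snd_zero, dilationV_apply_snd_zero]; abel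
      | succ n => rw [dilationT_apply_snd_succ, dilationV_apply_snd_succ]; abel
    refine (mul_norm_le_norm_ellTwoDiag (M := A + p • ContinuousLinearMap.adjoint A - s • 1) (by linarith)
      (mul_norm_le_norm_of_inner (hA.norm_inner_le h) hp) k.snd).trans ?_
    rw [e]
    refine (norm_sub_le _ _).trans (add_le_add (hg _) ?_)
    exact (ContinuousLinearMap.le_opNorm _ _).trans
      (mul_le_mul_of_nonneg_left (hg _) (norm_nonneg _))
  have h3 := mul_le_mul_of_nonneg_left hk (by linarith : 0 ≤ ‖s‖ - 2)
  linarith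

/-- The operator `R = 1 - bT + b²V` and its reversal `V - b̄T + b̄²` have equal norms at each
vector. If both are small at `k`, elimination gives `Tk ≈ sk` and `Vk ≈ pk` with `(s, p) = π(1/b,
b̄)`. There `|s| > 2` and `|p| = 1`, which the absence of approximate joint eigenvalues excludes. -/
theorem dilation_bounded_below (hA : IsFundamentalOperator S P A)
    (h : IsGammaContraction S P) {b : ℂ} (hb : ‖b‖ < 1) :
    ∃ c > 0, ∀ k, c * ‖k‖ ≤ ‖(1 - b • dilationT S P A + b ^ 2 • dilationV P) k‖ := by
  rcases eq_or_ne b 0 with rfl | hb0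
  · exact ⟨1, one_pos, fun k => by simp⟩
  have hi := isAlgGammaIsometry_dilation hA h
  set T := dilationT S P A
  set V := dilationV P
  set R := 1 - b • T + b ^ 2 • V with hR
  have hb0' : 0 < ‖b‖ := norm_pos_iff.2 hb0
  have hmem : R ∈ bicommutant T V :=
    add_mem (sub_mem (one_mem _) (Subalgebra.smul_mem _ (left_mem_bicommutant T V) _))
      (Subalgebra.smul_mem _ (right_mem_bicommutant T V) _)
  have hrev : IsReversal T V 1 R (V - conj b • T + conj b ^ 2 • 1) := by
    refine ⟨add_mem (sub_mem (right_mem_bicommutant T V)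
      (Subalgebra.smul_mem _ (left_mem_bicommutant T V) _))
      (Subalgebra.smul_mem _ (one_mem _) _), ?_⟩
    rw [star_add, star_sub, star_smul, star_smul, star_one, pow_one, add_mul, sub_mul,
      hi.isometry, smul_mul_assoc, ← hi.eq_star_mul, smul_mul_assoc, one_mul]
    simp [hR]
  set s : ℂ := (1 + (‖b‖ : ℂ) ^ 2) / b with hs
  set p : ℂ := conj b / b with hp
  have hsn : ‖s‖ = (1 + ‖b‖ ^ 2) / ‖b‖ := by
    rw [hs, norm_div]
    congr 1
    have : (1 + (‖b‖ : ℂ) ^ 2) = ((1 + ‖b‖ ^ 2 : ℝ) : ℂ) := by push_cast; rfl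
    rw [this, Complex.norm_real, Real.norm_eq_abs, abs_of_pos (by positivity)]
  have hs2 : 2 < ‖s‖ := by
    rw [hsn, lt_div_iff₀ hb0']
    nlinarith [sq_pos_of_pos (sub_pos.2 hb)]
  have hpn : ‖p‖ = 1 := by
    rw [hp, norm_div, RCLike.norm_conj, div_self hb0'.ne']
  have hbb : (‖b‖ : ℂ) ^ 2 = conj b * b := (Complex.conj_mul' b).symm
  set C := (1 + ‖b‖ ^ 2) / ((1 - ‖b‖ ^ 2) * ‖b‖) with hC
  have hb2 : 0 < 1 - ‖b‖ ^ 2 := by nlinarith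
  have hC0 : 0 < C := by positivity
  set N := ‖ellTwoDiag (ContinuousLinearMap.adjoint A)‖
  have hT : ∀ k, ‖T k - s • k‖ ≤ C * ‖R k‖ := fun k => by
    -- Subtracting `b²` times the reversal from `R` eliminates `V`.
    have e : ((1 - (‖b‖ : ℂ) ^ 2) * b) • (s • k - T k) =
        R k - b ^ 2 • (V - conj b • T + conj b ^ 2 • 1) k := by
      change _ = (k - b • T k + b ^ 2 • V k) - b ^ 2 • (V k - conj b • T k + conj b ^ 2 • k)
      rw [hbb, hs, hbb]
      have : ((1 - conj b * b) * b) • ((1 + conj b * b) / b) • k =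
        (1 - (conj b * b) ^ 2) • k := by
        rw [smul_smul]; congr 1; field_simp; ring
      rw [smul_sub, this]
      module
    have h1 := norm_sub_le (R k) (b ^ 2 • (V - conj b • T + conj b ^ 2 • 1) k)
    rw [← e, norm_smul, norm_smul, hrev.norm_apply hi hmem, norm_sub_rev, norm_mul, norm_pow] at h1
    have e2 : ‖(1 - (‖b‖ : ℂ) ^ 2)‖ = 1 - ‖b‖ ^ 2 := by
      have : (1 - (‖b‖ : ℂ) ^ 2) = ((1 - ‖b‖ ^ 2 : ℝ) : ℂ) := by push_cast; rfl
      rw [this, Complex.norm_real, Real.norm_eq_abs, abs_of_pos hb2]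
    rw [e2] at h1
    rw [hC, div_mul_eq_mul_div, le_div_iff₀ (by positivity)]
    linarith
  have hV : ∀ k, ‖V k - p • k‖ ≤ (1 + ‖b‖ * C) * ‖R k‖ := fun k => by
    have e : V k - p • k = (V - conj b • T + conj b ^ 2 • 1) k + conj b • (T k - s • k) := by
      change _ = (V k - conj b • T k + conj b ^ 2 • k) + conj b • (T k - s • k)
      have : conj b • s • k = p • k + conj b ^ 2 • k := by
        rw [smul_smul, ← add_smul, hs, hp, hbb]; congr 1; field_simp
      rw [smul_sub, this]
      abel
    rw [e]
    refine (norm_add_le _ _).trans ?_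
    rw [hrev.norm_apply hi hmem, norm_smul, RCLike.norm_conj]
    have := mul_le_mul_of_nonneg_left (hT k) hb0'.le
    linarith
  have hN : 0 ≤ N := norm_nonneg (ellTwoDiag (ContinuousLinearMap.adjoint A))
  have hD : 0 < 2 * C + N * (1 + ‖b‖ * C) := by positivity
  refine ⟨(‖s‖ - 2) / (2 * C + N * (1 + ‖b‖ * C)), div_pos (by linarith) hD, fun k => ?_⟩
  rw [div_mul_eq_mul_div, div_le_iff₀ hD]
  refine (dilation_joint_bounded_below hA h hs2 hpn k).trans ?_
  have h1 := hT k
  have h2 := mul_le_mul_of_nonneg_left (hV k) hN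
  linarith

/-- The pair `(T_A, V₀)` is a `Γ`-contraction. -/
theorem isGammaContraction_dilation (hA : IsFundamentalOperator S P A)
    (h : IsGammaContraction S P) : IsGammaContraction (dilationT S P A) (dilationV P) := by
  refine (isAlgGammaIsometry_dilation hA h).isGammaContraction fun b hb => ?_
  -- The path `t ↦ tb` joins the identity to the operator at `b` and stays in the disc.
  have h1 := isUnit_of_path_bounded_below
    (F := fun t : ℝ => 1 - ((t : ℂ) * b) • dilationT S P A + ((t : ℂ) * b) ^ 2 • dilationV P)
    (by fun_prop) ?_ fun t ht => ?_
  · simpa using h1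
  · simp only [Complex.ofReal_zero, zero_mul, ne_eq, OfNat.ofNat_ne_zero, not_false_eq_true,
      zero_pow]
    rw [zero_smul ℂ (dilationT S P A), zero_smul ℂ (dilationV P), sub_zero, add_zero]
    exact isUnit_one
  · refine dilation_bounded_below hA h ?_
    rw [norm_mul, Complex.norm_real, Real.norm_eq_abs, abs_of_nonneg ht.1]
    nlinarith [ht.2, norm_nonneg b, ht.1]

end DilationPair

/-! ### Compression of the dilation to `(S, P)` and to `(A, 0)`. -/

section Intertwining

/-- A linear relation between two spaces, preserved by both generators, is preserved by every
polynomial in them. Using relations instead of maps covers a compression defined only on an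
invariant subspace. -/
theorem polyOp_mem_of_invariant {K E : Type*} [NormedAddCommGroup K] [InnerProductSpace ℂ K]
    [NormedAddCommGroup E] [InnerProductSpace ℂ E] {T V : K →L[ℂ] K} {A B : E →L[ℂ] E}
    (r : Submodule ℂ (K × E)) (hT : ∀ z ∈ r, (T z.1, A z.2) ∈ r)
    (hV : ∀ z ∈ r, (V z.1, B z.2) ∈ r) (q : MvPolynomial (Fin 2) ℂ) {z : K × E} (hz : z ∈ r) :
    (polyOp q T V z.1, polyOp q A B z.2) ∈ r := by
  have h1 : ∀ j, ((V ^ j) z.1, (B ^ j) z.2) ∈ r := fun j => by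
    induction j with
    | zero => exact hz
    | succ j ih =>
      rw [pow_succ', pow_succ']
      exact hV _ ih
  have h2 : ∀ i j, ((T ^ i * V ^ j) z.1, (A ^ i * B ^ j) z.2) ∈ r := fun i j => by
    induction i with
    | zero => simpa using h1 j
    | succ i ih =>
      rw [pow_succ', pow_succ', mul_assoc, mul_assoc]
      exact hT _ ih
  have e : (polyOp q T V z.1, polyOp q A B z.2) = ∑ m ∈ q.support,
      q.coeff m • ((T ^ m 0 * V ^ m 1) z.1, (A ^ m 0 * B ^ m 1) z.2) := by
    refine Prod.ext ?_ ?_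
    · rw [Prod.fst_sum]
      simp only [polyOp, sum_apply]
      rfl
    · rw [Prod.snd_sum]
      simp only [polyOp, sum_apply]
      rfl
  rw [e]
  exact r.sum_mem fun m _ => r.smul_mem _ (h2 _ _)

variable {H : Type*} [NormedAddCommGroup H] [InnerProductSpace ℂ H] [CompleteSpace H]
  {S P : H →L[ℂ] H} {A : defectSpace P →L[ℂ] defectSpace P}

theorem polyOp_dilation_fst (q : MvPolynomial (Fin 2) ℂ) (k : DilationSpace P) :
    (polyOp q (dilationT S P A) (dilationV P) k).fst = polyOp q S P k.fst := by
  let r : Submodule ℂ (DilationSpace P × H) :=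
    { carrier := {z | z.1.fst = z.2}
      add_mem' := fun {a b} ha hb => congrArg₂ (· + ·) ha hb
      zero_mem' := rfl
      smul_mem' := fun c a ha => congrArg (c • ·) ha }
  exact polyOp_mem_of_invariant (T := dilationT S P A) (V := dilationV P) (A := S) (B := P) r
    (fun z hz => congrArg S hz) (fun z hz => congrArg P hz) q
    (z := (k, k.fst)) rfl

theorem polyOp_dilation_snd_zero (q : MvPolynomial (Fin 2) ℂ) {k : DilationSpace P}
    (hk : k.fst = 0) :
    (polyOp q (dilationT S P A) (dilationV P) k).snd 0 = polyOp q A 0 (k.snd 0) := by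
  let r : Submodule ℂ (DilationSpace P × defectSpace P) :=
    { carrier := {z | z.1.fst = 0 ∧ z.1.snd 0 = z.2}
      add_mem' := fun {a b} ha hb =>
        ⟨(congrArg₂ (· + ·) ha.1 hb.1).trans (add_zero _), congrArg₂ (· + ·) ha.2 hb.2⟩
      zero_mem' := ⟨rfl, rfl⟩
      smul_mem' := fun c a ha =>
        ⟨(congrArg (c • ·) ha.1).trans (smul_zero _), congrArg (c • ·) ha.2⟩ }
  refine (polyOp_mem_of_invariant r (fun z hz => ⟨?_, ?_⟩) (fun z hz => ⟨?_, ?_⟩) q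
    (z := (k, k.snd 0)) ⟨hk, rfl⟩).2
  · rw [dilationT_apply_fst, hz.1, map_zero]
  · rw [dilationT_apply_snd_zero, hz.1, map_zero, map_zero, zero_add, hz.2]
  · rw [dilationV_apply_fst, hz.1, map_zero]
  · rw [dilationV_apply_snd_zero, hz.1, map_zero]; rfl

/-- The inclusion of `ℓ²(𝒟_P)` into `H ⊕ ℓ²(𝒟_P)`. -/
noncomputable def dilationTail (P : H →L[ℂ] H) :
    EllTwo (defectSpace P) →L[ℂ] DilationSpace P :=
  (WithLp.prodContinuousLinearEquiv 2 ℂ H (EllTwo (defectSpace P))).symm.toContinuousLinearMap ∘L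
    ContinuousLinearMap.inr ℂ H (EllTwo (defectSpace P))

theorem dilationTail_fst (e : EllTwo (defectSpace P)) : (dilationTail P e).fst = 0 := rfl

theorem dilationTail_snd (e : EllTwo (defectSpace P)) : (dilationTail P e).snd = e := rfl

theorem norm_dilationTail (e : EllTwo (defectSpace P)) : ‖dilationTail P e‖ = ‖e‖ := by
  refine (sq_eq_sq₀ (norm_nonneg _) (norm_nonneg _)).1 ?_
  rw [WithLp.prod_norm_sq_eq_of_L2, dilationTail_fst, dilationTail_snd]
  simp

theorem dilationTail_of_fst_eq_zero {k : DilationSpace P} (hk : k.fst = 0) :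
    dilationTail P k.snd = k :=
  DilationSpace.ext hk.symm fun _ => rfl

/-- The embedding of `𝒟_P` as the `n`-th coordinate space of `H ⊕ ℓ²(𝒟_P)`. -/
noncomputable def dilationSingle (P : H →L[ℂ] H) (n : ℕ) :
    defectSpace P →ₗ[ℂ] DilationSpace P :=
  (dilationTail P).toLinearMap ∘ₗ lp.lsingle (𝕜 := ℂ) (E := fun _ : ℕ => defectSpace P) 2 n

theorem dilationSingle_fst (n : ℕ) (y : defectSpace P) : (dilationSingle P n y).fst = 0 := rfl

theorem dilationSingle_snd (n : ℕ) (y : defectSpace P) (m : ℕ) :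
    (dilationSingle P n y).snd m = if m = n then y else 0 := by
  change (Pi.single n y : ℕ → defectSpace P) m = _
  rw [Pi.single_apply]

theorem norm_dilationSingle (n : ℕ) (y : defectSpace P) : ‖dilationSingle P n y‖ = ‖y‖ := by
  change ‖dilationTail P (lp.single 2 n y)‖ = _
  rw [norm_dilationTail, lp.norm_single (by norm_num)]

theorem dilationV_dilationSingle (n : ℕ) (y : defectSpace P) :
    dilationV P (dilationSingle P n y) = dilationSingle P (n + 1) y := by
  refine DilationSpace.ext ?_ fun m => ?_
  · rw [dilationV_apply_fst, dilationSingle_fst, dilationSingle_fst, map_zero]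
  · cases m with
    | zero =>
      rw [dilationV_apply_snd_zero, dilationSingle_fst, map_zero, dilationSingle_snd]
      simp
    | succ m =>
      rw [dilationV_apply_snd_succ, dilationSingle_snd, dilationSingle_snd]
      simp

/-- The intertwining `T ι = ι A + V ι A*` required by the Cayley-Hamilton argument. -/
theorem dilationT_dilationSingle (y : defectSpace P) :
    dilationT S P A (dilationSingle P 0 y) = dilationSingle P 0 (A y) +
      dilationV P (dilationSingle P 0 (ContinuousLinearMap.adjoint A y)) := by
  rw [dilationV_dilationSingle]
  refine DilationSpace.ext ?_ fun m => ?_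
  · rw [WithLp.add_fst, dilationT_apply_fst, dilationSingle_fst, dilationSingle_fst,
      dilationSingle_fst, map_zero, add_zero]
  · change _ = (dilationSingle P 0 (A y)).snd m +
      (dilationSingle P 1 (ContinuousLinearMap.adjoint A y)).snd m
    rcases m with _ | _ | m
    · rw [dilationT_apply_snd_zero, dilationSingle_fst]
      simp [dilationSingle_snd]
    · rw [dilationT_apply_snd_succ]
      simp [dilationSingle_snd]
    · rw [dilationT_apply_snd_succ]
      simp [dilationSingle_snd]

/-- An operator commuting with `V₀` that kills the zeroth coordinate space kills `ℓ²(𝒟_P)`. -/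
theorem apply_eq_zero_of_dilationSingle {X : DilationSpace P →L[ℂ] DilationSpace P}
    (hX : Commute X (dilationV P)) (h0 : ∀ y, X (dilationSingle P 0 y) = 0)
    {k : DilationSpace P} (hk : k.fst = 0) : X k = 0 := by
  have h1 : ∀ n y, X (dilationSingle P n y) = 0 := fun n y => by
    induction n with
    | zero => exact h0 y
    | succ n ih =>
      rw [← dilationV_dilationSingle, ← mul_apply_eq_comp, hX.eq, mul_apply_eq_comp, ih, map_zero]
  have h2 := (lp.hasSum_single (p := 2) (by norm_num) k.snd).mapL (X ∘L dilationTail P)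
  rw [← dilationTail_of_fst_eq_zero hk]
  refine h2.unique ?_
  have h3 : ∀ n, (X ∘L dilationTail P) (lp.single 2 n (k.snd n)) = 0 := fun n => h1 n _
  simp only [h3]
  exact hasSum_zero

/-- Since `q(T_A, V₀)` is invertible, a preimage `k` exists. Its `H` component is killed by the
invertible `q(S, P)`, so `k` lies in `ℓ²(𝒟_P)`, where the zeroth coordinate transforms by `q(A, 0)`.
-/
theorem exists_polyOp_dilation_eq_dilationSingle (hA : IsFundamentalOperator S P A)
    (h : IsGammaContraction S P) {q : MvPolynomial (Fin 2) ℂ}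
    (hq : ∀ z ∈ closedSymmBidisc, polyVal q z ≠ 0) (y : defectSpace P) :
    ∃ k : DilationSpace P, k.fst = 0 ∧
      polyOp q (dilationT S P A) (dilationV P) k = dilationSingle P 0 y ∧
      polyOp q A 0 (k.snd 0) = y := by
  have hu := (isGammaContraction_dilation hA h).vonNeumann 1 q hq |>.1
  have hu' := h.vonNeumann 1 q hq |>.1
  obtain ⟨u, hu⟩ := hu
  obtain ⟨u', hu'⟩ := hu'
  set k := (↑u⁻¹ : DilationSpace P →L[ℂ] DilationSpace P) (dilationSingle P 0 y)
  have hk : polyOp q (dilationT S P A) (dilationV P) k = dilationSingle P 0 y := by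
    rw [← hu]; exact DFunLike.congr_fun u.mul_inv _
  have hk0 : k.fst = 0 := by
    have h1 := polyOp_dilation_fst (S := S) (A := A) q k
    rw [hk, dilationSingle_fst, ← hu'] at h1
    have h2 : (↑u'⁻¹ : H →L[ℂ] H) ((u' : H →L[ℂ] H) k.fst) = k.fst :=
      DFunLike.congr_fun u'.inv_mul _
    rw [← h2, ← h1, map_zero]
  refine ⟨k, hk0, hk, ?_⟩
  rw [← polyOp_dilation_snd_zero (S := S) q hk0, hk, dilationSingle_snd]
  simp

/-- The pair `(A, 0)` is a `Γ`-contraction. -/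
theorem isGammaContraction_fundamental [FiniteDimensional ℂ (defectSpace P)]
    (hA : IsFundamentalOperator S P A)
    (h : IsGammaContraction S P) : IsGammaContraction A 0 := by
  have hu : ∀ q : MvPolynomial (Fin 2) ℂ, (∀ z ∈ closedSymmBidisc, polyVal q z ≠ 0) →
      IsUnit (polyOp q A 0) := fun q hq => by
    rw [ContinuousLinearMap.isUnit_iff_bijective]
    have hs : Function.Surjective (polyOp q A 0) := fun y =>
      (exists_polyOp_dilation_eq_dilationSingle hA h hq y).elim fun k hk => ⟨_, hk.2.2⟩
    -- Finite dimension upgrades surjectivity to invertibility.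
    exact ⟨(LinearMap.injective_iff_surjective (f := (polyOp q A 0).toLinearMap)).2 hs, hs⟩
  have hc : Commute A 0 := Commute.zero_right A
  refine ⟨hc, taylorSpectrum_subset_closedSymmBidisc hc fun b hb => ?_, fun p q hq => ⟨hu q hq, ?_⟩⟩
  · have h1 := hu (1 - MvPolynomial.C b * MvPolynomial.X 0 + MvPolynomial.C (b ^ 2) *
      MvPolynomial.X 1) fun z hz => ?_
    · rw [← polyOpHom_apply hc] at h1
      simpa only [map_add, map_sub, map_mul, map_one, polyOpHom_C, polyOpHom_X_zero,
        polyOpHom_X_one, smul_mul_assoc, one_mul] using h1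
    · obtain ⟨w, ⟨h1, h2⟩, rfl⟩ := hz
      have hne : ∀ c : ℂ, ‖c‖ ≤ 1 → 1 - b * c ≠ 0 := fun c hc1 h0 => by
        have := congrArg norm (sub_eq_zero.1 h0)
        rw [norm_one, norm_mul] at this
        nlinarith [norm_nonneg b, norm_nonneg c]
      have e : polyVal (1 - MvPolynomial.C b * MvPolynomial.X 0 + MvPolynomial.C (b ^ 2) *
          MvPolynomial.X 1) (symmMap w) = (1 - b * w.1) * (1 - b * w.2) := by
        simp [polyVal, symmMap]
        ring
      rw [e]
      exact mul_ne_zero (hne _ h1) (hne _ h2)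
  · set M := sSup ((fun z => ‖polyVal p z / polyVal q z‖) '' closedSymmBidisc)
    have hM : 0 ≤ M := by
      refine Real.sSup_nonneg ?_
      rintro _ ⟨z, -, rfl⟩
      exact norm_nonneg _
    refine ContinuousLinearMap.opNorm_le_bound _ hM fun y => ?_
    obtain ⟨k, hk0, hk1, hk2⟩ := exists_polyOp_dilation_eq_dilationSingle hA h hq y
    obtain ⟨hv1, hv2⟩ := (isGammaContraction_dilation hA h).vonNeumann p q hq
    -- The value at `y` is the zeroth coordinate of `p/q` of the dilation applied to `y` placed
    -- there, so the dilation's bound passes down.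
    have e1 : (polyOp p A 0 * Ring.inverse (polyOp q A 0)) y = polyOp p A 0 (k.snd 0) := by
      rw [← hk2, ← mul_apply_eq_comp, mul_assoc, Ring.inverse_mul_cancel _ (hu q hq), mul_one]
    have e2 : polyOp p (dilationT S P A) (dilationV P) k =
        (polyOp p (dilationT S P A) (dilationV P) *
          Ring.inverse (polyOp q (dilationT S P A) (dilationV P))) (dilationSingle P 0 y) := by
      rw [← hk1, ← mul_apply_eq_comp, mul_assoc, Ring.inverse_mul_cancel _ hv1, mul_one]
    rw [e1, ← polyOp_dilation_snd_zero (S := S) p hk0]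
    refine (lp.norm_apply_le_norm (by norm_num) _ 0).trans ?_
    have h3 : ‖(polyOp p (dilationT S P A) (dilationV P) k).snd‖ ≤
        ‖polyOp p (dilationT S P A) (dilationV P) k‖ := by
      refine le_of_sq_le_sq ?_ (norm_nonneg _)
      rw [WithLp.prod_norm_sq_eq_of_L2 (polyOp p (dilationT S P A) (dilationV P) k)]
      nlinarith [sq_nonneg ‖(polyOp p (dilationT S P A) (dilationV P) k).fst‖]
    refine h3.trans ?_
    rw [e2]
    refine (ContinuousLinearMap.le_opNorm _ _).trans ?_
    rw [norm_dilationSingle]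
    exact mul_le_mul_of_nonneg_right hv2 (norm_nonneg _)

end Intertwining

/-! ### Eigenvalues of `A + pA*` when the numerical radius is at most one. -/

section NumericalRange

theorem mem_spectrum_of_apply_eq_smul {E : Type*} [NormedAddCommGroup E] [NormedSpace ℂ E]
    {A : E →L[ℂ] E} {l : ℂ} {v : E} (hv : v ≠ 0) (h : A v = l • v) :
    l ∈ spectrum ℂ A := by
  intro hu
  obtain ⟨u, hu⟩ := hu
  refine hv ?_
  have h1 : (u : E →L[ℂ] E) v = 0 := by
    rw [hu, sub_apply, h, Algebra.algebraMap_eq_smul_one]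
    exact sub_self _
  have h2 : (↑u⁻¹ : E →L[ℂ] E) ((u : E →L[ℂ] E) v) = v := DFunLike.congr_fun u.inv_mul v
  rw [← h2, h1, map_zero]

variable {E : Type*} [NormedAddCommGroup E] [InnerProductSpace ℂ E] [CompleteSpace E]
  {A : E →L[ℂ] E}

/-- Vectors at which a numerical range contained in the closed disc touches the unit circle. -/
theorem two_smul_eq_of_norm_inner_eq_one (hw : ∀ y, ‖inner ℂ y (A y)‖ ≤ ‖y‖ ^ 2) {v : E}
    (hv : ‖v‖ = 1) (ha : ‖inner ℂ v (A v)‖ = 1) :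
    (2 : ℂ) • v = conj (inner ℂ v (A v)) • A v +
      inner ℂ v (A v) • ContinuousLinearMap.adjoint A v := by
  set a := inner ℂ v (A v) with ha'
  set B : E →L[ℂ] E := (2 : ℂ) • 1 - (conj a • A + a • ContinuousLinearMap.adjoint A) with hB
  have hBx : ∀ x, inner ℂ x (B x) = ((2 * ‖x‖ ^ 2 - 2 * (conj a * inner ℂ x (A x)).re : ℝ) : ℂ) := by
    intro x
    change inner ℂ x ((2 : ℂ) • x - (conj a • A x + a • ContinuousLinearMap.adjoint A x)) = _
    rw [inner_sub_right, inner_add_right, inner_smul_right, inner_smul_right, inner_smul_right,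
      ContinuousLinearMap.adjoint_inner_right, ← inner_conj_symm (A x) x,
      inner_self_eq_norm_sq_to_K]
    have h1 := Complex.add_conj (conj a * inner ℂ x (A x))
    rw [map_mul, Complex.conj_conj] at h1
    push_cast at h1 ⊢
    rw [h1]
    rfl
  -- A positive operator whose quadratic form vanishes at `v` annihilates `v`, via its square root.
  have hpos : 0 ≤ B := by
    rw [ContinuousLinearMap.nonneg_iff_isPositive, ContinuousLinearMap.isPositive_def']
    refine ⟨?_, fun x => ?_⟩
    · rw [IsSelfAdjoint, hB, star_sub, star_add, star_smul, star_smul, star_smul, star_one]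
      simp only [ContinuousLinearMap.star_eq_adjoint, ContinuousLinearMap.adjoint_adjoint]
      rw [add_comm]
      simp
    · rw [ContinuousLinearMap.reApplyInnerSelf_apply, inner_re_symm, hBx]
      have h1 := Complex.re_le_norm (conj a * inner ℂ x (A x))
      rw [norm_mul, RCLike.norm_conj, ha, one_mul] at h1
      have h2 := hw x
      change 0 ≤ (2 * ‖x‖ ^ 2 - 2 * (conj a * inner ℂ x (A x)).re : ℝ)
      linarith
  have hC : CFC.sqrt B * CFC.sqrt B = B := CFC.sqrt_mul_sqrt_self B hpos
  have hCs : ContinuousLinearMap.adjoint (CFC.sqrt B) = CFC.sqrt B :=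
    (IsSelfAdjoint.of_nonneg (CFC.sqrt_nonneg B)).star_eq
  have h0 : inner ℂ v (B v) = 0 := by
    rw [hBx, ← ha', Complex.conj_mul', ha, hv]
    norm_num
  have h1 : CFC.sqrt B v = 0 := by
    rw [← hC, mul_apply_eq_comp, ← hCs, ContinuousLinearMap.adjoint_inner_right, hCs] at h0
    exact inner_self_eq_zero.1 h0
  have h2 : B v = 0 := by
    rw [← hC, mul_apply_eq_comp, h1, map_zero]
  exact sub_eq_zero.1 h2

/-- If `A` has numerical radius at most one and spectral radius less than one, then the eigenvalues
`s` of `A + p A*` with `|p| < 1` satisfy `(s, p) ∈ 𝔾₂`. -/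
theorem norm_sub_lt_of_eigenvector (hw : ∀ y, ‖inner ℂ y (A y)‖ ≤ ‖y‖ ^ 2)
    (hr : ∀ l ∈ spectrum ℂ A, ‖l‖ < 1) {s p : ℂ} (hp : ‖p‖ < 1) {v : E} (hv : v ≠ 0)
    (h : A v + p • ContinuousLinearMap.adjoint A v = s • v) :
    ‖s - conj s * p‖ < 1 - ‖p‖ ^ 2 := by
  wlog hv1 : ‖v‖ = 1 generalizing v
  · refine this (v := (‖v‖⁻¹ : ℂ) • v) (smul_ne_zero (by simpa using hv) hv) ?_ ?_
    · rw [map_smul, map_smul, smul_comm p, ← smul_add, h, smul_comm s]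
    · rw [norm_smul, norm_inv, Complex.norm_real, norm_norm,
        inv_mul_cancel₀ (norm_ne_zero_iff.2 hv)]
  set a := inner ℂ v (A v) with ha
  have hs : s = a + p * conj a := by
    have h1 := congrArg (inner ℂ v) h
    rw [inner_add_right, inner_smul_right, inner_smul_right,
      ContinuousLinearMap.adjoint_inner_right, ← inner_conj_symm (A v),
      inner_self_eq_norm_sq_to_K, hv1, ← ha] at h1
    simpa using h1.symm
  -- If `|a| = 1`, the relations `2v = āAv + aA*v` and `Av + pA*v = sv` can be solved for `Av`
  -- because `|p| < 1`. Then `v` is an eigenvector of `A` with eigenvalue `a` on the unit circle,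
  -- contrary to the spectral bound.
  have ha1 : ‖a‖ < 1 := by
    have h1 := hw v
    rw [hv1, one_pow] at h1
    refine lt_of_le_of_ne h1 fun h2 => ?_
    have h3 := two_smul_eq_of_norm_inner_eq_one hw hv1 h2
    rw [← ha] at h3
    have hne : a - p * conj a ≠ 0 := fun h0 => by
      have := congrArg norm (sub_eq_zero.1 h0)
      rw [norm_mul, RCLike.norm_conj, h2, mul_one] at this
      exact hp.ne this.symm
    have h4 : (a - p * conj a) • A v = (a * s - 2 * p) • v := by
      have e1 : a • s • v = a • A v + p • a • ContinuousLinearMap.adjoint A v := by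
        rw [← h, smul_add, smul_comm a p]
      have e2 : a • ContinuousLinearMap.adjoint A v = (2 : ℂ) • v - conj a • A v :=
        (sub_eq_of_eq_add' h3).symm
      rw [e2] at e1
      rw [sub_smul, sub_smul, mul_smul a s, e1]
      module
    have h5 : A v = ((a - p * conj a)⁻¹ * (a * s - 2 * p)) • v := by
      rw [mul_smul, ← h4, smul_smul, inv_mul_cancel₀ hne, one_smul]
    have h6 : a = (a - p * conj a)⁻¹ * (a * s - 2 * p) := by
      have h6 := congrArg (inner ℂ v) h5
      rw [inner_smul_right, inner_self_eq_norm_sq_to_K, hv1, ← ha] at h6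
      simpa using h6
    have h7 := hr _ (mem_spectrum_of_apply_eq_smul hv h5)
    rw [← h6] at h7
    exact h7.ne h2
  have e : s - conj s * p = a * ((1 - ‖p‖ ^ 2 : ℝ) : ℂ) := by
    rw [hs]
    push_cast
    rw [← Complex.conj_mul']
    simp only [map_add, map_mul, Complex.conj_conj]
    ring
  have hp2 : 0 < 1 - ‖p‖ ^ 2 := by nlinarith [norm_nonneg p]
  rw [e, norm_mul, Complex.norm_real, Real.norm_eq_abs, abs_of_pos hp2]
  nlinarith

end NumericalRange

/-! ### The determinantal polynomial of the pencil and Cayley-Hamilton. -/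

section PencilPolynomial

open MvPolynomial

variable {E : Type*} [NormedAddCommGroup E] [InnerProductSpace ℂ E] [FiniteDimensional ℂ E]

/-- The matrix of the pencil `s - A - p B`, with polynomial entries in `(s, p)`. -/
noncomputable def pencilMatrix (A B : E →L[ℂ] E) :
    Matrix (Fin (Module.finrank ℂ E)) (Fin (Module.finrank ℂ E)) (MvPolynomial (Fin 2) ℂ) :=
  (X 0 : MvPolynomial (Fin 2) ℂ) • 1 -
    (LinearMap.toMatrix (Module.finBasis ℂ E) (Module.finBasis ℂ E) A.toLinearMap).map C -
    (X 1 : MvPolynomial (Fin 2) ℂ) •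
      (LinearMap.toMatrix (Module.finBasis ℂ E) (Module.finBasis ℂ E) B.toLinearMap).map C

theorem exists_eigenvector_of_det_pencilMatrix {A B : E →L[ℂ] E} {z : ℂ × ℂ}
    (h : polyVal (pencilMatrix A B).det z = 0) : ∃ v ≠ 0, A v + z.2 • B v = z.1 • v := by
  set b := Module.finBasis ℂ E
  have e : (pencilMatrix A B).map (eval ![z.1, z.2]) =
      LinearMap.toMatrix b b (z.1 • LinearMap.id - A.toLinearMap - z.2 • B.toLinearMap) := by
    rw [map_sub, map_sub, map_smul, map_smul, LinearMap.toMatrix_id]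
    ext i j
    simp [pencilMatrix, Matrix.one_apply, apply_ite, b]
  have h1 : LinearMap.det (z.1 • LinearMap.id - A.toLinearMap - z.2 • B.toLinearMap) = 0 := by
    rw [← LinearMap.det_toMatrix b, ← e]
    rw [← RingHom.mapMatrix_apply, ← RingHom.map_det]
    exact h
  obtain ⟨v, hv, hv0⟩ := Submodule.exists_mem_ne_zero_of_ne_bot
    (LinearMap.bot_lt_ker_of_det_eq_zero h1).ne'
  refine ⟨v, hv0, ?_⟩
  have h2 : z.1 • v - A v - z.2 • B v = 0 := hv
  rw [sub_sub, sub_eq_zero] at h2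
  exact h2.symm

/-- A Cayley-Hamilton theorem: `det (T - A - V B)` annihilates the range of an intertwiner `ι` with
`T ι = ι A + V ι B`. -/
theorem polyOp_det_pencilMatrix_apply {K : Type*} [NormedAddCommGroup K] [InnerProductSpace ℂ K]
    {T V : K →L[ℂ] K} (hc : Commute T V) {A B : E →L[ℂ] E} (ι : E →ₗ[ℂ] K)
    (hι : ∀ y, T (ι y) = ι (A y) + V (ι (B y))) (y : E) :
    polyOp (pencilMatrix A B).det T V (ι y) = 0 := by
  set b := Module.finBasis ℂ E with hb
  set M := pencilMatrix A B with hM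
  set φ := polyOpHom hc with hφ
  -- This is the intertwining relation written in the basis; multiplying by the adjugate turns it
  -- into the vanishing of the determinant.
  have h1 : ∀ j, ∑ i, φ (M i j) (ι (b i)) = 0 := fun j => by
    have e : ∀ i, φ (M i j) (ι (b i)) = (if i = j then T (ι (b i)) else 0) -
        LinearMap.toMatrix b b A.toLinearMap i j • ι (b i) -
        V (LinearMap.toMatrix b b B.toLinearMap i j • ι (b i)) := fun i => by
      simp only [hM, pencilMatrix, Matrix.sub_apply, Matrix.smul_apply, Matrix.map_apply,
        Matrix.one_apply, smul_eq_mul, map_sub, map_mul, sub_apply, hφ, polyOpHom_C,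
        polyOpHom_X_zero, polyOpHom_X_one, mul_apply_eq_comp]
      congr 1
      · congr 1
        split_ifs
        · rw [map_one]; rfl
        · rw [map_zero]; simp
    rw [Finset.sum_congr rfl fun i _ => e i, Finset.sum_sub_distrib, Finset.sum_sub_distrib,
      Finset.sum_ite_eq' Finset.univ j, if_pos (Finset.mem_univ _), ← map_sum V, hι]
    have e2 : ∀ L : E →L[ℂ] E,
        ∑ i, LinearMap.toMatrix b b L.toLinearMap i j • ι (b i) = ι (L (b j)) := fun L => by
      simp only [← map_smul, ← map_sum]
      congr 1
      simp only [LinearMap.toMatrix_apply]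
      exact b.sum_repr (L (b j))
    rw [e2, e2]
    abel
  have h2 : ∀ l, φ M.det (ι (b l)) = 0 := fun l => by
    have e : ∑ i, φ ((M * M.adjugate) i l) (ι (b i)) = 0 := by
      simp only [Matrix.mul_apply, map_sum, sum_apply]
      rw [Finset.sum_comm]
      refine Finset.sum_eq_zero fun j _ => ?_
      simp only [mul_comm (M _ j), map_mul, mul_apply_eq_comp]
      rw [← map_sum, h1, map_zero]
    rw [Matrix.mul_adjugate] at e
    rw [← e, Finset.sum_eq_single l]
    · simp
    · intro i _ hi
      simp [hi]
    · simp
  rw [← polyOpHom_apply hc, ← b.sum_repr y, map_sum, map_sum]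
  refine Finset.sum_eq_zero fun l _ => ?_
  rw [map_smul, map_smul, h2, smul_zero]

end PencilPolynomial

/-! ### Distinguished polynomials and the three implications. -/

/-- The zero in `𝔾₂` is supplied by `q`, so `p` need not have one. This covers `𝒟_P = 0`, where the
pencil determinant is the constant `1`. -/
theorem IsGammaDistinguishedPoly.mul_left {p q : MvPolynomial (Fin 2) ℂ}
    (hq : IsGammaDistinguishedPoly q)
    (hp : ∀ z ∈ frontier closedSymmBidisc, polyVal p z = 0 → z ∈ symmBidiscDistBoundary) :
    IsGammaDistinguishedPoly (p * q) := by
  have hz : ∀ z, z ∈ polyZeros (p * q) ↔ polyVal p z = 0 ∨ polyVal q z = 0 := fun z => by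
    change polyVal (p * q) z = 0 ↔ _
    rw [polyVal_mul, mul_eq_zero]
  refine ⟨hq.1.mono fun z h => ⟨(hz z).2 (Or.inr h.1), h.2⟩, ?_⟩
  refine Set.Subset.antisymm (fun z h => ⟨h.1, ?_⟩) fun z h =>
    ⟨h.1, symmBidiscDistBoundary_subset_frontier h.2⟩
  rcases (hz z).1 h.1 with h1 | h1
  · exact hp z h.2 h1
  · exact (hq.2.subset ⟨h1, h.2⟩).2

section MainTheorem

variable {H : Type*} [NormedAddCommGroup H] [InnerProductSpace ℂ H] [CompleteSpace H]
  {S P : H →L[ℂ] H} {A : defectSpace P →L[ℂ] defectSpace P}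

theorem isGammaDistinguished_fundamental_of_dilation [FiniteDimensional ℂ (defectSpace P)]
    (hA : IsFundamentalOperator S P A) (h : IsGammaContraction S P)
    (hd : IsGammaDistinguished (dilationT S P A) (dilationV P)) : IsGammaDistinguished A 0 := by
  obtain ⟨-, q, hq, hq0⟩ := hd
  refine ⟨isGammaContraction_fundamental hA h, q, hq, ContinuousLinearMap.ext fun y => ?_⟩
  have h1 := polyOp_dilation_snd_zero (S := S) (A := A) q (dilationSingle_fst (P := P) 0 y)
  rw [hq0, dilationSingle_snd, if_pos rfl] at h1
  exact h1.symm

theorem polyOp_apply_of_eigenvector {E : Type*} [NormedAddCommGroup E] [InnerProductSpace ℂ E]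
    {A B : E →L[ℂ] E} (hc : Commute A B) {s p : ℂ} {v : E} (hA : A v = s • v) (hB : B v = p • v)
    (q : MvPolynomial (Fin 2) ℂ) : polyOp q A B v = polyVal q (s, p) • v := by
  rw [← polyOpHom_apply hc]
  induction q using MvPolynomial.induction_on with
  | C c => rw [polyOpHom_C]; simp [polyVal]
  | add q r hq hr =>
    rw [map_add, add_apply, hq, hr, ← add_smul]
    simp [polyVal]
  | mul_X q i hq =>
    have hi : i = 0 ∨ i = 1 := by fin_cases i <;> simp
    rw [map_mul, mul_apply_eq_comp]
    rcases hi with rfl | rfl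
    · rw [polyOpHom_X_zero, hA, map_smul, hq, smul_smul, mul_comm]
      simp [polyVal]
    · rw [polyOpHom_X_one, hB, map_smul, hq, smul_smul, mul_comm]
      simp [polyVal]

theorem spectralRadius_lt_one_of_isGammaDistinguished {E : Type*} [NormedAddCommGroup E]
    [InnerProductSpace ℂ E] [FiniteDimensional ℂ E] {A : E →L[ℂ] E}
    (hd : IsGammaDistinguished A 0) : spectralRadius ℂ A < 1 := by
  have : CompleteSpace E := FiniteDimensional.complete ℂ E
  have hl : ∀ l ∈ spectrum ℂ A, ‖l‖ < 1 := fun l hl => by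
    obtain ⟨v, hv, hAv⟩ : ∃ v ≠ 0, A v = l • v := by
      rw [spectrum.mem_iff, ContinuousLinearMap.isUnit_iff_bijective] at hl
      by_contra! hn
      refine hl ?_
      have hi : Function.Injective (algebraMap ℂ (E →L[ℂ] E) l - A) := by
        rw [injective_iff_map_eq_zero]
        intro v hv
        by_contra hv0
        refine hn v hv0 ?_
        rw [Algebra.algebraMap_eq_smul_one] at hv
        exact (sub_eq_zero.1 hv).symm
      exact ⟨hi, (LinearMap.injective_iff_surjective
        (f := (algebraMap ℂ (E →L[ℂ] E) l - A).toLinearMap)).1 hi⟩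
    obtain ⟨hc, q, hq, hq0⟩ := hd
    have hz : polyVal q (l, 0) = 0 := by
      have h1 := polyOp_apply_of_eigenvector hc.comm hAv (B := 0) (p := 0) (by simp) q
      rw [hq0] at h1
      exact (smul_eq_zero.1 h1.symm).resolve_right hv
    have hle : (l, (0 : ℂ)) ∈ closedSymmBidisc := hc.spectrum_subset fun hex => by
      have h1 : koszulD0 (A - l • 1) (0 - (0 : ℂ) • 1) v =
          koszulD0 (A - l • 1) (0 - (0 : ℂ) • 1) 0 := by
        refine Prod.ext ?_ ?_
        · change A v - l • v = (A - l • 1) 0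
          rw [hAv, sub_self, map_zero]
        · change (0 - (0 : ℂ) • (1 : E →L[ℂ] E)) v = (0 - (0 : ℂ) • (1 : E →L[ℂ] E)) 0
          simp
      exact hv (hex.1 h1)
    have hle1 : ‖l‖ ≤ 1 := by
      obtain ⟨w, ⟨h1, h2⟩, hw⟩ := hle
      obtain ⟨e1, e2⟩ := Prod.mk.inj hw
      rw [← e1]
      rcases mul_eq_zero.1 e2 with h | h <;> simp [h, h1, h2]
    refine lt_of_le_of_ne hle1 fun h1 => ?_
    have h2 := norm_snd_of_mem_symmBidiscDistBoundary
      (hq.2.subset ⟨hz, mk_zero_mem_frontier h1⟩).2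
    simp at h2
  -- The spectrum is empty when the space is zero.
  rcases (spectrum ℂ A).eq_empty_or_nonempty with he | hne
  · simp [spectralRadius, he]
  · have := spectrum.spectralRadius_lt_of_forall_lt_of_nonempty hne (r := 1)
      fun k hk => by exact_mod_cast hl k hk
    simpa using this

theorem isGammaDistinguished_dilation_of_spectralRadius_lt_one
    [FiniteDimensional ℂ (defectSpace P)] (hA : IsFundamentalOperator S P A)
    (hd : IsGammaDistinguished S P) (hr : spectralRadius ℂ A < 1) :
    IsGammaDistinguished (dilationT S P A) (dilationV P) := by
  obtain ⟨h, q, hq, hq0⟩ := hd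
  have hl : ∀ l ∈ spectrum ℂ A, ‖l‖ < 1 := fun l hl => by
    have h1 : (‖l‖₊ : ENNReal) ≤ spectralRadius ℂ A := le_iSup₂ (α := ENNReal) l hl
    have h2 := h1.trans_lt hr
    exact_mod_cast h2
  have hc := commute_dilation hA h
  refine ⟨isGammaContraction_dilation hA h,
    (pencilMatrix A (ContinuousLinearMap.adjoint A)).det * q, hq.mul_left fun z hz h0 => ?_, ?_⟩
  · have hzΓ := frontier_closedSymmBidisc_subset hz
    refine mem_symmBidiscDistBoundary_of_norm_snd hzΓ ?_
    -- If `|p| < 1`, then `s` is an eigenvalue of `A + pA*`, which makes `(s, p)` interior to `Γ`.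
    refine le_antisymm (norm_snd_le_of_mem_closedSymmBidisc hzΓ) (le_of_not_gt fun hp => ?_)
    obtain ⟨v, hv0, hv⟩ := exists_eigenvector_of_det_pencilMatrix h0
    exact notMem_frontier_of_lt
      (norm_sub_lt_of_eigenvector (hA.norm_inner_le h) hl hp hv0 hv) hz
  · rw [polyOp_mul hc]
    refine ContinuousLinearMap.ext fun k => ?_
    rw [mul_apply_eq_comp]
    have hV : polyOp (MvPolynomial.X 1) (dilationT S P A) (dilationV P) = dilationV P := by
      rw [← polyOpHom_apply hc, polyOpHom_X_one]
    have h1 := polyOp_comm hc (pencilMatrix A (ContinuousLinearMap.adjoint A)).det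
      (MvPolynomial.X 1)
    rw [hV] at h1
    refine apply_eq_zero_of_dilationSingle h1 (fun y => polyOp_det_pencilMatrix_apply hc
      (dilationSingle P 0) dilationT_dilationSingle y) ?_
    -- The factor `q` sends every vector into `ℓ²(𝒟_P)`, since its `H` component is computed by
    -- `q(S, P) = 0`.
    rw [polyOp_dilation_fst, hq0]
    rfl

end MainTheorem

theorem theorem9p3 {H : Type*} [NormedAddCommGroup H] [InnerProductSpace ℂ H] [CompleteSpace H]
    (S P : H →L[ℂ] H) (hSP : IsGammaDistinguished S P)
    (hfin : FiniteDimensional ℂ (defectSpace P))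
    (A : defectSpace P →L[ℂ] defectSpace P) (hA : IsFundamentalOperator S P A) :
    List.TFAE [
      IsGammaDistinguished (dilationT S P A) (dilationV P),
      IsGammaDistinguished A 0,
      spectralRadius ℂ A < 1] := by
  tfae_have 1 → 2 := isGammaDistinguished_fundamental_of_dilation hA hSP.1
  tfae_have 2 → 3 := spectralRadius_lt_one_of_isGammaDistinguished
  tfae_have 3 → 1 := isGammaDistinguished_dilation_of_spectralRadius_lt_one hA hSP
  tfae_finish
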